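/- Let $(x_0,y_0)\in\mathbb R^2$, and let $\mathcal R_{(x_0,y_0)}$ be the real algebra of all rational functions $g=p/q\in\mathbb R(x,y)$ ($p,q$ coprime polynomials) that are bounded in some neighbourhood of $(x_0,y_0)$; where $q$ vanishes, the value of $g$ is, by convention, the iterated limit $g(a,b)=\lim_{x\to a}\lim_{y\to b}g(x,y)$ whenever this exists and is finite. For $f\in\mathcal R_{(x_0,y_0)}$ let $D_f(x_0,y_0)=\bigcap_V\overline{f(V)}$, where $V$ runs over all neighbourhoods of $(x_0,y_0)$, be the set of limiting values of $f$ at $(x_0,y_0)$. Let $\mathcal I$ be the set of all functions $\Phi(t)=\sum_{k=1}^N\varphi_k|t|^{e_k}$ with $N\ge 0$, $\varphi_k\in\mathbb R\setminus\{0\}$, $e_k\in\mathbb Q$ and $1\le e_1<\dots<e_N$ (so $\Phi=0$ for $N=0$). A character of $\mathcal R_{(x_0,y_0)}$ is a nontrivial homomorphism of real algebras $\chi:\mathcal R_{(x_0,y_0)}\to\mathbb R$. It is determined by a net $(x_\gamma,y_\gamma)\to(x_0,y_0)$ if $\chi(g)=\lim_\gamma g(x_\gamma,y_\gamma)$ for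 all $g\in\mathcal R_{(x_0,y_0)}$, and by a branch of a curve through $(x_0,y_0)$ if $\chi(g)$ is the limit of $g$ along that branch at $(x_0,y_0)$ for all $g\in\mathcal R_{(x_0,y_0)}$. Let $X^1_{(x_0,y_0)}$ be the set of characters determined by a net $(x_\gamma,y_\gamma)\to(x_0,y_0)$ such that either $x_\gamma-x_0$ has a constant strict sign, $\frac{y_\gamma-y_0}{x_\gamma-x_0}$ has a finite limit, and for some $\Phi\in\mathcal I$ one has $\lim_\gamma\frac{y_\gamma-y_0-\Phi(x_\gamma-x_0)}{|x_\gamma-x_0|^{e}}=0$ for every $e\in\mathbb R$, or the same holds with the roles of $x$ and $y$ exchanged. Theorem. For every $f\in\mathcal R_{(x_0,y_0)}$ and every $d\in D_f(x_0,y_0)$ there is a character $\chi\in X^1_{(x_0,y_0)}$ with $\chi(f)=d$; moreover, $\chi$ can be chosen so that for some $\Phi\in\mathcal I$ it is determined by one of the branches $x>x_0$, $x<x_0$ of the curve $y=y_0+\Phi(x-x_0)$ or by one of the branches $y>y_0$, $y<y_0$ of the curve $x=x_0+\Phi(y-y_0)$. In particular, $f$ tends to $d$ along that branch. -/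

import Mathlib

open Filter Topology

noncomputable section

namespace RatLim

/-- Real polynomials in two variables; variable `0` is `x` and variable `1` is `y`. -/
abbrev Poly2 : Type := MvPolynomial (Fin 2) ℝ

/-- The real rational functions in two variables. -/
abbrev Rat2 : Type := FractionRing Poly2

/-- The value `p(x, y)` of a polynomial at the point `w = (x, y)`. -/
def pval (p : Poly2) (w : ℝ × ℝ) : ℝ := MvPolynomial.eval ![w.1, w.2] p

/-- The numerator in the representation `f = p / q` with `p`, `q` mutually prime. -/
def num (f : Rat2) : Poly2 := IsFractionRing.num Poly2 f

/-- The denominator in the representation `f = p / q` with `p`, `q` mutually prime. -/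
def den (f : Rat2) : Poly2 := (IsFractionRing.den Poly2 f : Poly2)

/-- The quotient `p(w) / q(w)` for the reduced representation `f = p / q`; it is the value of `f`
at `w` when `q(w) ≠ 0`. -/
def quot (f : Rat2) (w : ℝ × ℝ) : ℝ := pval (num f) w / pval (den f) w

open Classical in
/-- The value of `f` at `w`: `p(w) / q(w)` where the denominator of the reduced representation does
not vanish, and the iterated limit `lim_{x → w₁} lim_{y → w₂} f(x, y)` otherwise. (This is the
convention that defines a rational function at its points of bounded discontinuity.) -/
def value (f : Rat2) (w : ℝ × ℝ) : ℝ :=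
  if pval (den f) w ≠ 0 then quot f w
  else limUnder (𝓝[≠] w.1) fun x => limUnder (𝓝[≠] w.2) fun y => quot f (x, y)

/-- `f` is bounded in some neighbourhood of `z`. Points where the reduced denominator vanishes are
left out: the values there, if any, are limits of values at the other points, so they obey the
same bound. -/
def BoundedNear (f : Rat2) (z : ℝ × ℝ) : Prop :=
  ∃ C : ℝ, ∀ᶠ w in 𝓝 z, pval (den f) w ≠ 0 → |quot f w| ≤ C

lemma continuous_pval (p : Poly2) : Continuous (pval p) := by
  unfold pval
  refine (MvPolynomial.continuous_eval p).comp ?_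
  refine continuous_pi fun i => ?_
  fin_cases i
  · exact continuous_fst
  · exact continuous_snd

lemma dense_pval_ne_zero {q : Poly2} (hq : q ≠ 0) : Dense {w : ℝ × ℝ | pval q w ≠ 0} := by
  intro w
  rw [mem_closure_iff_nhds]
  intro U hU
  by_contra hne
  rw [Set.not_nonempty_iff_eq_empty] at hne
  have hzero : ∀ v ∈ U, pval q v = 0 := by
    intro v hv
    by_contra h
    exact (Set.eq_empty_iff_forall_notMem.mp hne v) ⟨hv, h⟩
  rw [nhds_prod_eq] at hU
  obtain ⟨A, hA, B, hB, hAB⟩ := Filter.mem_prod_iff.mp hU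
  refine hq (MvPolynomial.funext_set ![A, B] ?_ ?_)
  · intro i
    fin_cases i
    · exact infinite_of_mem_nhds _ hA
    · exact infinite_of_mem_nhds _ hB
  · intro v hv
    have h0 : v 0 ∈ A := hv 0 (Set.mem_univ _)
    have h1 : v 1 ∈ B := hv 1 (Set.mem_univ _)
    have h := hzero (v 0, v 1) (hAB ⟨h0, h1⟩)
    have hvv : ![v 0, v 1] = v := by
      ext i
      fin_cases i <;> rfl
    simpa [pval, hvv] using h

lemma den_ne_zero (f : Rat2) : den f ≠ 0 := nonZeroDivisors.coe_ne_zero _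

lemma num_div_den (f : Rat2) :
    algebraMap Poly2 Rat2 (num f) / algebraMap Poly2 Rat2 (den f) = f :=
  IsFractionRing.mk'_num_den' Poly2 f

lemma boundedNear_of_eq_div {f : Rat2} {z : ℝ × ℝ} (a b : Poly2) (hb : b ≠ 0)
    (hf : f = algebraMap Poly2 Rat2 a / algebraMap Poly2 Rat2 b) (C : ℝ)
    (hC : ∀ᶠ w in 𝓝 z, pval b w ≠ 0 → |pval a w / pval b w| ≤ C) : BoundedNear f z := by
  have inj := IsFractionRing.injective Poly2 Rat2
  have hcross : num f * b = a * den f := by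
    apply inj
    have hb' : algebraMap Poly2 Rat2 b ≠ 0 := by
      simpa using (map_ne_zero_iff _ inj).mpr hb
    have hd' : algebraMap Poly2 Rat2 (den f) ≠ 0 := (map_ne_zero_iff _ inj).mpr (den_ne_zero f)
    have := (num_div_den f).trans hf
    rw [div_eq_div_iff hd' hb'] at this
    simpa [map_mul] using this
  refine ⟨C, ?_⟩
  filter_upwards [hC.eventually_nhds] with w hw hdw
  have hcont : ContinuousAt (fun v => |quot f v|) w :=
    (((continuous_pval _).continuousAt).div ((continuous_pval _).continuousAt) hdw).abs
  by_contra hlt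
  push Not at hlt
  have h1 : ∀ᶠ v in 𝓝 w, C < |quot f v| := hcont.eventually (lt_mem_nhds hlt)
  have h2 : ∀ᶠ v in 𝓝 w, pval (den f) v ≠ 0 :=
    (continuous_pval _).continuousAt.eventually_ne hdw
  obtain ⟨v, ⟨⟨hv1, hv2⟩, hv3⟩, hv4⟩ :=
    mem_closure_iff_nhds.mp (dense_pval_ne_zero hb w) _ ((h1.and h2).and hw)
  have hv4' : pval b v ≠ 0 := hv4
  have hev : pval (num f) v * pval b v = pval a v * pval (den f) v := by
    have := congrArg (fun p => pval p v) hcross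
    simpa [pval] using this
  have : quot f v = pval a v / pval b v := by
    unfold quot
    rw [div_eq_div_iff hv2 hv4']
    exact hev
  have := hv3 hv4'
  simp_all only [ne_eq, not_false_eq_true]
  linarith

/-- The real algebra of the rational functions that are bounded in some neighbourhood of `z`. -/
def boundedRat (z : ℝ × ℝ) : Subalgebra ℝ Rat2 where
  carrier := {f | BoundedNear f z}
  mul_mem' := by
    rintro f g ⟨C, hC⟩ ⟨D, hD⟩
    refine boundedNear_of_eq_div (num f * num g) (den f * den g)
      (mul_ne_zero (den_ne_zero f) (den_ne_zero g)) ?_ (C * D) ?_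
    · rw [map_mul, map_mul, mul_div_mul_comm, num_div_den, num_div_den]
    · filter_upwards [hC, hD] with w hf hg hne
      simp only [pval, map_mul] at hne ⊢
      have h1 := hf (left_ne_zero_of_mul hne)
      have h2 := hg (right_ne_zero_of_mul hne)
      rw [mul_div_mul_comm, abs_mul]
      exact mul_le_mul h1 h2 (abs_nonneg _) ((abs_nonneg _).trans h1)
  add_mem' := by
    rintro f g ⟨C, hC⟩ ⟨D, hD⟩
    have inj := IsFractionRing.injective Poly2 Rat2
    refine boundedNear_of_eq_div (num f * den g + den f * num g) (den f * den g)
      (mul_ne_zero (den_ne_zero f) (den_ne_zero g)) ?_ (C + D) ?_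
    · rw [map_mul, map_add, map_mul, map_mul, ← div_add_div _ _
        ((map_ne_zero_iff _ inj).mpr (den_ne_zero f))
        ((map_ne_zero_iff _ inj).mpr (den_ne_zero g)), num_div_den, num_div_den]
    · filter_upwards [hC, hD] with w hf hg hne
      simp only [pval, map_mul, map_add] at hne ⊢
      have h1 := hf (left_ne_zero_of_mul hne)
      have h2 := hg (right_ne_zero_of_mul hne)
      rw [← div_add_div _ _ (left_ne_zero_of_mul hne) (right_ne_zero_of_mul hne)]
      exact (abs_add_le _ _).trans (add_le_add h1 h2)
  algebraMap_mem' := by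
    intro r
    refine boundedNear_of_eq_div (MvPolynomial.C r) 1 one_ne_zero ?_ |r| ?_
    · rw [map_one, div_one]
      exact IsScalarTower.algebraMap_apply ℝ Poly2 Rat2 r
    · exact Filter.Eventually.of_forall fun w _ => by simp [pval]

/-- The set of limiting values of `f` at `z`: the intersection of the closures of `f(V)` over all
neighbourhoods `V` of `z`. -/
def limitingValues (f : Rat2) (z : ℝ × ℝ) : Set ℝ :=
  ⋂ V ∈ 𝓝 z, closure (value f '' V)

/-- The (nontrivial) real characters of the algebra of rational functions bounded near `z`. -/
abbrev Character (z : ℝ × ℝ) : Type := boundedRat z →ₐ[ℝ] ℝ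

/-- The finite sums `Φ(t) = ∑ₖ φₖ |t| ^ eₖ` with nonzero real coefficients `φₖ` and strictly
increasing rational exponents `eₖ ≥ 1`; the empty sum `Φ = 0` is included. -/
def puiseuxSums : Set (ℝ → ℝ) :=
  {Φ | ∃ (N : ℕ) (φ : Fin N → ℝ) (e : Fin N → ℚ), (∀ k, φ k ≠ 0) ∧ (∀ k, 1 ≤ e k) ∧
    StrictMono e ∧ Φ = fun t => ∑ k, φ k * |t| ^ ((e k : ℚ) : ℝ)}

/-- `χ` is determined by the family of points `γ` along the filter `l`: the points tend to `z`, and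
`χ(g)` is the limit of `g` along the family for every `g` in the algebra. -/
def DeterminedAlong {ι : Type} {z : ℝ × ℝ} (χ : Character z) (l : Filter ι) (γ : ι → ℝ × ℝ) :
    Prop :=
  Tendsto γ l (𝓝 z) ∧ ∀ g : boundedRat z, Tendsto (fun i => value (g : Rat2) (γ i)) l (𝓝 (χ g))

/-- `χ` is determined by one of the two branches (`x > x₀` or `x < x₀`) of the curve
`y = y₀ + Φ(x - x₀)`. -/
def DeterminedByGraphX {x₀ y₀ : ℝ} (χ : Character (x₀, y₀)) (Φ : ℝ → ℝ) : Prop :=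
  DeterminedAlong χ (𝓝[>] x₀) (fun x => (x, y₀ + Φ (x - x₀))) ∨
  DeterminedAlong χ (𝓝[<] x₀) (fun x => (x, y₀ + Φ (x - x₀)))

/-- `χ` is determined by one of the two branches (`y > y₀` or `y < y₀`) of the curve
`x = x₀ + Φ(y - y₀)`. -/
def DeterminedByGraphY {x₀ y₀ : ℝ} (χ : Character (x₀, y₀)) (Φ : ℝ → ℝ) : Prop :=
  DeterminedAlong χ (𝓝[>] y₀) (fun y => (x₀ + Φ (y - y₀), y)) ∨
  DeterminedAlong χ (𝓝[<] y₀) (fun y => (x₀ + Φ (y - y₀), y))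

/-- The condition on a family of pairs `(u, v)` (along `l`) that `u` keeps a strict sign, `v / u` has
a finite limit, and `v` agrees with `Φ(u)` to every order: `(v - Φ(u)) / |u| ^ e → 0` for every
real `e`, for some finite sum `Φ` of rational powers. -/
def FlatToPuiseuxSum {ι : Type} (l : Filter ι) (u v : ι → ℝ) : Prop :=
  ((∀ i, 0 < u i) ∨ (∀ i, u i < 0)) ∧
  (∃ c : ℝ, Tendsto (fun i => v i / u i) l (𝓝 c)) ∧
  ∃ Φ ∈ puiseuxSums, ∀ e : ℝ, Tendsto (fun i => (v i - Φ (u i)) / |u i| ^ e) l (𝓝 0)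

/-- The class `X¹` of characters at `(x₀, y₀)`: those determined by a net of points that tends to
`(x₀, y₀)` and agrees to every order with a curve `y = y₀ + Φ(x - x₀)` or `x = x₀ + Φ(y - y₀)`. -/
def X1 (x₀ y₀ : ℝ) : Set (Character (x₀, y₀)) :=
  {χ | ∃ (Γ : Type) (_ : Preorder Γ) (_ : IsDirectedOrder Γ) (_ : Nonempty Γ) (γ : Γ → ℝ × ℝ),
    DeterminedAlong χ atTop γ ∧
    (FlatToPuiseuxSum atTop (fun i => (γ i).1 - x₀) (fun i => (γ i).2 - y₀) ∨
     FlatToPuiseuxSum atTop (fun i => (γ i).2 - y₀) (fun i => (γ i).1 - x₀))}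

end RatLim

end

noncomputable section

namespace RatLim

open Polynomial Asymptotics

/-! Write `f = p / q` in lowest terms. Coprimality puts into the ideal `(p, q)` a nonzero polynomial
in `x` alone and another in `y` alone; with `|p| ≤ K |q|` near the point, both are `O(q)`. Hence
zeros of `q` are isolated, and off the line `x = x₀`, `|q|` is bounded below by a constant times a
power `|x - x₀| ^ n` (`BoundedNear.exists_le_den_fst`, `BoundedNear.eventually_den_ne_zero`).

A limiting value `d` is the limit of `f` along an ultrafilter on the punctured neighbourhood, and
this ultrafilter lies in one of four cones; in suitable coordinates the cone is `|v| ≤ u`, `u > 0`.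
On each segment `|v| ≤ u` the minimum of `|f - d|` is attained at a root of one fixed nonzero
polynomial `F(u, ·)` (`exists_root_abs_div_le`), so the points may be moved onto the algebraic curve
`F = 0` without losing the limit `d`. By a Newton–Puiseux argument (`rootsApproximable`,
`puiseuxApprox_of_root`) the ratio `v / u` on that curve agrees up to `O(u ^ n)` with a polynomial
`h` in `u ^ (1 / m)`. This changes `v` by `O(u ^ (n + 1))` and, by the lower bound on `q`, the value
of `f` by only `O(u)` (`exists_curve_of_tendsto_in_cone`).

Along `v = u * h(u ^ (1 / m))` every locally bounded `g` has a limit, since `u = τ ^ m` makes it a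
bounded quotient of polynomials in one variable. These limits form a character (`exists_character`),
and its value at `f` must be `d`. -/

/-! ### Elimination of one variable -/

/-- Two relatively prime polynomials over a domain with Gauss's lemma generate an ideal that contains
a nonzero constant. -/
lemma exists_mul_add_mul_eq_C_of_isRelPrime {R : Type*} [CommRing R] [IsDomain R]
    [NormalizedGCDMonoid R] {p q : R[X]} (h : IsRelPrime p q) :
    ∃ (a b : R[X]) (r : R), r ≠ 0 ∧ a * p + b * q = C r := by
  classical
  let K := FractionRing R
  let φ := algebraMap R K
  have hφ : Function.Injective φ := IsFractionRing.injective R K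
  have hnorm : ∀ s : K[X], ∃ c : R, c ≠ 0 ∧
      (IsLocalization.integerNormalization (nonZeroDivisors R) s).map φ = C (φ c) * s := by
    intro s
    obtain ⟨c, hc, hs⟩ := IsLocalization.integerNormalization_spec (nonZeroDivisors R) s
    refine ⟨c, nonZeroDivisors.ne_zero hc, hs.trans ?_⟩
    rw [algebra_compatible_smul K c s, smul_eq_C_mul]
  let g : K[X] := EuclideanDomain.gcd (p.map φ) (q.map φ)
  have hg0 : g ≠ 0 := by
    intro hg
    rw [EuclideanDomain.gcd_eq_zero_iff, Polynomial.map_eq_zero_iff hφ,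
      Polynomial.map_eq_zero_iff hφ] at hg
    rw [hg.1, hg.2, isRelPrime_zero_left] at h
    exact not_isUnit_zero h
  -- Gauss's lemma: `π` is primitive and divides `p` and `q` over the fraction field, hence over
  -- `R`, so it is a unit. Then `g` is a unit too, and clearing denominators in its Bézout identity
  -- produces the constant `c * e`.
  let π := (IsLocalization.integerNormalization (nonZeroDivisors R) g).primPart
  have hπ : π.map φ ∣ g := by
    obtain ⟨c, hc, hs⟩ := hnorm g
    have h2 : π.map φ ∣ C (φ c) * g := hs ▸ Polynomial.map_dvd _ (primPart_dvd _)
    have hu : IsUnit (C (φ c)) :=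
      isUnit_C.mpr ((map_ne_zero_iff φ hφ).mpr hc).isUnit
    exact (hu.dvd_mul_left).mp h2
  have hdvd : ∀ s : R[X], g ∣ s.map φ → π ∣ s := fun s hs =>
    IsPrimitive.dvd_of_fraction_map_dvd_fraction_map (isPrimitive_primPart _) (hπ.trans hs)
  have hu : IsUnit π := h (hdvd p (EuclideanDomain.gcd_dvd_left _ _))
    (hdvd q (EuclideanDomain.gcd_dvd_right _ _))
  have hgu : IsUnit g := isUnit_or_eq_zero_of_isUnit_integerNormalization_primPart hg0 hu
  obtain ⟨a, b, hab⟩ := (EuclideanDomain.gcd_isUnit_iff.mp hgu)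
  obtain ⟨c, hc, hca⟩ := hnorm a
  obtain ⟨e, he, heb⟩ := hnorm b
  refine ⟨C e * IsLocalization.integerNormalization (nonZeroDivisors R) a,
    C c * IsLocalization.integerNormalization (nonZeroDivisors R) b, c * e, mul_ne_zero hc he, ?_⟩
  apply map_injective φ hφ
  simp only [Polynomial.map_add, Polynomial.map_mul, hca, heb, map_C, map_mul]
  linear_combination C (φ c) * C (φ e) * hab

/-- Evaluating a polynomial at elements of an algebra, followed by a real point of that algebra. -/
lemma algHom_aeval_eq_pval {A : Type*} [CommRing A] [Algebra ℝ A] (φ : A →ₐ[ℝ] ℝ) (a b : A)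
    (p : Poly2) : φ (MvPolynomial.aeval ![a, b] p) = pval p (φ a, φ b) := by
  rw [← AlgHom.comp_apply, MvPolynomial.comp_aeval, pval, MvPolynomial.aeval_def,
    MvPolynomial.eval, MvPolynomial.coe_eval₂Hom]
  congr 1
  funext i
  fin_cases i <;> rfl

lemma eval_aeval_eq_pval (t : ℝ) (a b : ℝ[X]) (p : Poly2) :
    (MvPolynomial.aeval ![a, b] p).eval t = pval p (a.eval t, b.eval t) := by
  simpa [Polynomial.coe_aeval_eq_eval] using algHom_aeval_eq_pval (Polynomial.aeval t) a b p

lemma evalEval_aeval_eq_pval (u v : ℝ) (a b : ℝ[X][X]) (p : Poly2) :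
    (MvPolynomial.aeval ![a, b] p).evalEval u v = pval p (a.evalEval u v, b.evalEval u v) := by
  simpa only [Polynomial.coe_aevalAeval_eq_evalEval] using
    algHom_aeval_eq_pval (Polynomial.aevalAeval u v) a b p

/-- A relatively prime pair of polynomials in two variables generates an ideal that contains a
nonzero polynomial in the first variable only. -/
lemma exists_elimination_fst {p q : Poly2} (h : IsRelPrime p q) :
    ∃ (a b : Poly2) (r : ℝ[X]), r ≠ 0 ∧
      ∀ w : ℝ × ℝ, pval a w * pval p w + pval b w * pval q w = r.eval w.1 := by
  obtain ⟨_⟩ : Nonempty (NormalizedGCDMonoid ℝ[X]) := inferInstance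
  let e := Polynomial.Bivariate.equivMvPolynomial ℝ
  have h' : IsRelPrime (e.symm p) (e.symm q) := by
    intro d hp hq
    have := @h (e d) (by simpa using map_dvd e hp) (by simpa using map_dvd e hq)
    simpa using this
  obtain ⟨a, b, r, hr, hab⟩ := exists_mul_add_mul_eq_C_of_isRelPrime h'
  refine ⟨e a, e b, r, hr, fun w => ?_⟩
  have h1 : e a * p + e b * q = e (C r) := by rw [← hab]; simp
  have h2 : ((MvPolynomial.aeval ![w.1, w.2] : Poly2 →ₐ[ℝ] ℝ).comp
      (e.toAlgHom.comp (Polynomial.CAlgHom (R := ℝ) (A := ℝ[X])))) = aeval w.1 := by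
    ext
    simp [e]
  have h3 := congrArg (fun s => pval s w) h1
  simp only [pval, map_add, map_mul] at h3 ⊢
  rw [h3]
  exact congrArg (fun φ => φ r) h2

lemma exists_elimination_snd {p q : Poly2} (h : IsRelPrime p q) :
    ∃ (a b : Poly2) (r : ℝ[X]), r ≠ 0 ∧
      ∀ w : ℝ × ℝ, pval a w * pval p w + pval b w * pval q w = r.eval w.2 := by
  let e := MvPolynomial.renameEquiv ℝ (Equiv.swap (0 : Fin 2) 1)
  have hev : ∀ (s : Poly2) (w : ℝ × ℝ), pval (e s) w = pval s w.swap := by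
    intro s w
    simp only [pval, e, MvPolynomial.renameEquiv_apply, MvPolynomial.eval_rename]
    congr 2
    funext i
    fin_cases i <;> simp
  have h' : IsRelPrime (e p) (e q) := by
    intro d hp hq
    have := @h (e.symm d) (by simpa using map_dvd e.symm hp) (by simpa using map_dvd e.symm hq)
    simpa using this
  obtain ⟨a, b, r, hr, hab⟩ := exists_elimination_fst h'
  refine ⟨e a, e b, r, hr, fun w => ?_⟩
  simpa [hev] using hab w.swap

/-! ### Quotients of polynomials in one variable -/

/-- A nonzero real polynomial does not vanish on a punctured neighbourhood of a point. -/
lemma eventually_eval_ne_zero {r : ℝ[X]} (hr : r ≠ 0) (x : ℝ) :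
    ∀ᶠ t in 𝓝[≠] x, r.eval t ≠ 0 := by
  have hfin : ({t | r.IsRoot t} \ {x} : Set ℝ).Finite :=
    (Polynomial.finite_setOfPred_isRoot hr).subset Set.sdiff_subset
  have : ({t | r.IsRoot t} \ {x} : Set ℝ)ᶜ ∈ 𝓝 x :=
    hfin.isClosed.isOpen_compl.mem_nhds (by simp)
  filter_upwards [mem_nhdsWithin_of_mem_nhds this, self_mem_nhdsWithin] with t ht hne h0
  exact ht ⟨h0, hne⟩

lemma exists_eq_X_pow_mul {r : ℝ[X]} (hr : r ≠ 0) :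
    ∃ (n : ℕ) (s : ℝ[X]), s.eval 0 ≠ 0 ∧ r = X ^ n * s := by
  obtain ⟨n, s, hs, h⟩ := WfDvdMonoid.max_power_factor hr (irreducible_X (R := ℝ))
  refine ⟨n, s, ?_, h⟩
  rwa [X_dvd_iff, coeff_zero_eq_eval_zero] at hs

/-- A bounded quotient of two real polynomials in one variable has a limit. -/
lemma exists_tendsto_div_of_bounded (A B : ℝ[X]) (K : ℝ) {l : Filter ℝ} (hl : l ≤ 𝓝[≠] 0)
    (h : ∀ᶠ t in l, |A.eval t| ≤ K * |B.eval t|) :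
    ∃ L, Tendsto (fun t => A.eval t / B.eval t) l (𝓝 L) := by
  rcases l.eq_or_neBot with rfl | hne
  · exact ⟨0, tendsto_bot⟩
  have hl0 : l ≤ 𝓝 0 := hl.trans nhdsWithin_le_nhds
  have hne0 : ∀ᶠ t in l, t ≠ 0 := hl self_mem_nhdsWithin
  have hcont : ∀ s : ℝ[X], Tendsto (fun t => s.eval t) l (𝓝 (s.eval 0)) := fun s =>
    (s.continuous.tendsto 0).mono_left hl0
  rcases eq_or_ne B 0 with rfl | hB
  · exact ⟨0, by simp⟩
  rcases eq_or_ne A 0 with rfl | hA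
  · exact ⟨0, by simp⟩
  obtain ⟨n, B', hB', rfl⟩ := exists_eq_X_pow_mul hB
  obtain ⟨k, A', hA', rfl⟩ := exists_eq_X_pow_mul hA
  -- If `A` vanished to lower order than `B`, dividing the bound by `|t| ^ k` and letting `t → 0`
  -- would give `A'(0) = 0`.
  have hnk : n ≤ k := by
    by_contra! hlt
    obtain ⟨j, rfl⟩ := Nat.exists_eq_add_of_lt hlt
    have h1 : ∀ᶠ t in l, |A'.eval t| ≤ K * |(X ^ (j + 1) * B').eval t| := by
      filter_upwards [h, hne0] with t ht h0
      simp only [eval_mul, eval_pow, eval_X, abs_mul, abs_pow] at ht ⊢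
      have hpos : 0 < |t| ^ k := by positivity
      refine le_of_mul_le_mul_left (ht.trans_eq ?_) hpos
      ring
    have h2 := le_of_tendsto_of_tendsto (hcont A').abs ((hcont (X ^ (j + 1) * B')).abs.const_mul K) h1
    simp at h2
    exact hA' h2
  obtain ⟨j, rfl⟩ := Nat.exists_eq_add_of_le hnk
  refine ⟨_, ((hcont (X ^ j * A')).div (hcont B') hB').congr' ?_⟩
  filter_upwards [hne0] with t h0
  simp only [eval_mul, eval_pow, eval_X]
  rw [pow_add, mul_assoc, mul_div_mul_left _ _ (pow_ne_zero _ h0), Pi.div_apply]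

/-! ### Denominators and values of locally bounded rational functions -/

lemma isRelPrime_num_den (f : Rat2) : IsRelPrime (num f) (den f) :=
  IsFractionRing.num_den_reduced Poly2 f

/-- The cleared inequality is a closed condition, so it extends from the dense set where the
denominator is nonzero to the zeros of the denominator. -/
lemma BoundedNear.abs_num_le {f : Rat2} {z : ℝ × ℝ} (hf : BoundedNear f z) :
    ∃ K : ℝ, 0 < K ∧ ∀ᶠ w in 𝓝 z, |pval (num f) w| ≤ K * |pval (den f) w| := by
  obtain ⟨K, hK⟩ := hf
  refine ⟨max K 1, by positivity, ?_⟩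
  filter_upwards [hK.eventually_nhds] with w hw
  have hcl : w ∈ closure {v | pval (den f) v ≠ 0 ∧ |quot f v| ≤ K} := by
    rw [mem_closure_iff_nhds]
    intro U hU
    obtain ⟨v, hv, hv'⟩ := mem_closure_iff_nhds.mp (dense_pval_ne_zero (den_ne_zero f) w) _
      (inter_mem hU hw)
    exact ⟨v, hv.1, hv', hv.2 hv'⟩
  have hclosed : IsClosed {v | |pval (num f) v| ≤ max K 1 * |pval (den f) v|} :=
    isClosed_le (continuous_pval _).abs (continuous_const.mul (continuous_pval _).abs)
  refine closure_minimal ?_ hclosed hcl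
  rintro v ⟨h0, hv⟩
  rw [quot, abs_div, div_le_iff₀ (abs_pos.mpr h0)] at hv
  exact hv.trans (by gcongr; exact le_max_left _ _)

lemma abs_combination_le {p q a b : Poly2} {z : ℝ × ℝ} {K : ℝ}
    (hK : ∀ᶠ w in 𝓝 z, |pval p w| ≤ K * |pval q w|) :
    ∃ K', ∀ᶠ w in 𝓝 z, |pval a w * pval p w + pval b w * pval q w| ≤ K' * |pval q w| := by
  have hbd : ∀ s : Poly2, ∀ᶠ w in 𝓝 z, |pval s w| ≤ |pval s z| + 1 := fun s =>
    ((continuous_pval s).abs.continuousAt.eventually (gt_mem_nhds (lt_add_one _))).mono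
      fun _ h => le_of_lt h
  refine ⟨(|pval a z| + 1) * K + (|pval b z| + 1), ?_⟩
  filter_upwards [hK, hbd a, hbd b] with w hp ha hb
  calc |pval a w * pval p w + pval b w * pval q w|
      ≤ |pval a w| * |pval p w| + |pval b w| * |pval q w| := by
        rw [← abs_mul, ← abs_mul]; exact abs_add_le _ _
    _ ≤ (|pval a z| + 1) * (K * |pval q w|) + (|pval b z| + 1) * |pval q w| := by gcongr
    _ = _ := by ring

/-- The eliminated polynomial `r = a * p + b * q` is `O(q)` because `p` is. This is the only lower
bound on the denominator that the proof needs in horizontal cones. -/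
lemma BoundedNear.exists_le_den_fst {f : Rat2} {z : ℝ × ℝ} (hf : BoundedNear f z) :
    ∃ (r : ℝ[X]) (K : ℝ), r ≠ 0 ∧ ∀ᶠ w in 𝓝 z, |r.eval w.1| ≤ K * |pval (den f) w| := by
  obtain ⟨K, -, hK⟩ := hf.abs_num_le
  obtain ⟨a, b, r, hr, hab⟩ := exists_elimination_fst (isRelPrime_num_den f)
  obtain ⟨K', hK'⟩ := abs_combination_le (a := a) (b := b) hK
  exact ⟨r, K', hr, hK'.mono fun w hw => hab w ▸ hw⟩

lemma BoundedNear.exists_le_den_snd {f : Rat2} {z : ℝ × ℝ} (hf : BoundedNear f z) :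
    ∃ (r : ℝ[X]) (K : ℝ), r ≠ 0 ∧ ∀ᶠ w in 𝓝 z, |r.eval w.2| ≤ K * |pval (den f) w| := by
  obtain ⟨K, -, hK⟩ := hf.abs_num_le
  obtain ⟨a, b, r, hr, hab⟩ := exists_elimination_snd (isRelPrime_num_den f)
  obtain ⟨K', hK'⟩ := abs_combination_le (a := a) (b := b) hK
  exact ⟨r, K', hr, hK'.mono fun w hw => hab w ▸ hw⟩

/-- The zeros of the reduced denominator of a locally bounded rational function are isolated. -/
lemma BoundedNear.eventually_den_ne_zero {f : Rat2} {z : ℝ × ℝ} (hf : BoundedNear f z) :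
    ∀ᶠ w in 𝓝[≠] z, pval (den f) w ≠ 0 := by
  obtain ⟨r, K, hr, hK⟩ := hf.exists_le_den_fst
  obtain ⟨s, K', hs, hK'⟩ := hf.exists_le_den_snd
  have h1 := eventually_nhdsWithin_iff.mp (eventually_eval_ne_zero hr z.1)
  have h2 := eventually_nhdsWithin_iff.mp (eventually_eval_ne_zero hs z.2)
  refine eventually_nhdsWithin_iff.mpr ?_
  filter_upwards [hK, hK', (continuous_fst.tendsto z).eventually h1,
    (continuous_snd.tendsto z).eventually h2] with w hw hw' hr' hs' hne h0
  -- At a zero of the denominator both eliminated polynomials vanish, which near `z` forces each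
  -- coordinate to be that of `z`.
  rw [h0, abs_zero, mul_zero, abs_nonpos_iff] at hw hw'
  refine hne (Prod.ext ?_ ?_)
  · by_contra h
    exact hr' h hw
  · by_contra h
    exact hs' h hw'

lemma BoundedNear.eventually_value_eq {f : Rat2} {z : ℝ × ℝ} (hf : BoundedNear f z) :
    ∀ᶠ w in 𝓝[≠] z, value f w = quot f w := by
  filter_upwards [hf.eventually_den_ne_zero] with w hw
  rw [value, if_pos hw]

/-- A locally bounded rational function has a limit along every polynomial curve. -/
lemma BoundedNear.exists_tendsto_polynomial_curve {f : Rat2} (a b : ℝ[X])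
    (hf : BoundedNear f (a.eval 0, b.eval 0)) {l : Filter ℝ} (hl : l ≤ 𝓝[≠] 0) :
    ∃ L, Tendsto (fun t => quot f (a.eval t, b.eval t)) l (𝓝 L) := by
  obtain ⟨K, -, hK⟩ := hf.abs_num_le
  have ht : Tendsto (fun t => (a.eval t, b.eval t)) l (𝓝 (a.eval 0, b.eval 0)) :=
    ((a.continuous.prodMk b.continuous).tendsto 0).mono_left (hl.trans nhdsWithin_le_nhds)
  obtain ⟨L, hL⟩ := exists_tendsto_div_of_bounded (MvPolynomial.aeval ![a, b] (num f))
    (MvPolynomial.aeval ![a, b] (den f)) K hl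
    (by simpa only [eval_aeval_eq_pval] using ht.eventually hK)
  exact ⟨L, by simpa only [eval_aeval_eq_pval, quot] using hL⟩

lemma BoundedNear.exists_tendsto_horizontal {f : Rat2} {z : ℝ × ℝ} (hf : BoundedNear f z) :
    ∃ L, Tendsto (fun x => quot f (x, z.2)) (𝓝[≠] z.1) (𝓝 L) := by
  obtain ⟨L, hL⟩ := BoundedNear.exists_tendsto_polynomial_curve (f := f) (C z.1 + X) (C z.2)
    (by simpa using hf) le_rfl
  have ht : Tendsto (fun x => x - z.1) (𝓝[≠] z.1) (𝓝[≠] 0) := by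
    refine tendsto_nhdsWithin_iff.mpr ⟨?_, ?_⟩
    · exact ((continuous_id.sub continuous_const).tendsto' _ _ (sub_self _)).mono_left
        nhdsWithin_le_nhds
    · filter_upwards [self_mem_nhdsWithin] with x hx
      exact sub_ne_zero.mpr hx
  exact ⟨L, by simpa [Function.comp_def] using hL.comp ht⟩

lemma tendsto_mk_nhdsNE (z : ℝ × ℝ) :
    Tendsto (fun x => (x, z.2)) (𝓝[≠] z.1) (𝓝[≠] z) := by
  refine tendsto_nhdsWithin_iff.mpr ⟨?_, ?_⟩
  · exact ((continuous_id.prodMk continuous_const).tendsto' _ _ rfl).mono_left nhdsWithin_le_nhds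
  · filter_upwards [self_mem_nhdsWithin] with x hx h
    exact hx (congrArg Prod.fst h)

/-- The value at a point is the limit along the horizontal line through it. -/
lemma BoundedNear.tendsto_horizontal {f : Rat2} {z : ℝ × ℝ} (hf : BoundedNear f z) :
    Tendsto (fun x => quot f (x, z.2)) (𝓝[≠] z.1) (𝓝 (value f z)) := by
  have hcont : ∀ w, pval (den f) w ≠ 0 → ContinuousAt (quot f) w := fun w hw =>
    (continuous_pval _).continuousAt.div (continuous_pval _).continuousAt hw
  by_cases h0 : pval (den f) z ≠ 0
  · rw [value, if_pos h0]
    exact (hcont z h0).tendsto.comp ((tendsto_mk_nhdsNE z).mono_right nhdsWithin_le_nhds)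
  · rw [value, if_neg h0]
    obtain ⟨L, hL⟩ := hf.exists_tendsto_horizontal
    -- Zeros of the denominator being isolated, `f` is continuous at `(x, z.2)` for `x` near but
    -- different from `z.1`, so the inner limit is the quotient there.
    have h1 : ∀ᶠ x in 𝓝[≠] z.1, (limUnder (𝓝[≠] z.2) fun y => quot f (x, y)) = quot f (x, z.2) := by
      filter_upwards [(tendsto_mk_nhdsNE z).eventually hf.eventually_den_ne_zero] with x hx
      refine Tendsto.limUnder_eq ?_
      exact (hcont _ hx).tendsto.comp
        (((continuous_const.prodMk continuous_id).tendsto' _ _ rfl).mono_left nhdsWithin_le_nhds)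
    have h2 := hL.congr' (h1.mono fun _ h => h.symm)
    rw [h2.limUnder_eq]
    exact hL

/-- A limiting value is a cluster value of the quotient at nearby points. -/
lemma BoundedNear.mapClusterPt_of_mem_limitingValues {f : Rat2} {z : ℝ × ℝ}
    (hf : BoundedNear f z) {d : ℝ} (hd : d ∈ limitingValues f z) :
    MapClusterPt d (𝓝[≠] z) (quot f) := by
  rw [mapClusterPt_iff_frequently]
  intro s hs hev
  obtain ⟨s', hs's, hs'o, hds'⟩ := mem_nhds_iff.mp hs
  have h1 := eventually_nhdsWithin_iff.mp (hev.and hf.eventually_value_eq)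
  obtain ⟨-, hv, w, hw, rfl⟩ := mem_closure_iff.mp (Set.mem_iInter₂.mp hd _ h1) s' hs'o hds'
  -- The neighbourhood may meet `s'` only through the value at `z` itself; that value is a
  -- horizontal limit, so nearby points serve instead.
  by_cases hwz : w = z
  · subst hwz
    obtain ⟨x, hx, hx'⟩ := ((hf.tendsto_horizontal.eventually (hs'o.mem_nhds hv)).and
      ((tendsto_mk_nhdsNE w).eventually hev)).exists
    exact hx' (hs's hx)
  · have h2 := hw hwz
    exact h2.1 (hs's (h2.2 ▸ hv))

/-! ### Newton–Puiseux approximation of real roots -/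

lemma eval_eval_eq_evalEval (G : ℝ[X][X]) (h : ℝ[X]) (t : ℝ) :
    (G.eval h).eval t = G.evalEval t (h.eval t) := by
  rw [← eval₂_evalRingHom]
  simpa using hom_eval₂ G (RingHom.id _) (evalRingHom t) h

lemma evalEval_eq_eval_map (G : ℝ[X][X]) (u v : ℝ) :
    G.evalEval u v = (G.map (evalRingHom u)).eval v := (map_evalRingHom_eval u v G).symm

lemma continuous_evalEval (G : ℝ[X][X]) : Continuous fun w : ℝ × ℝ => G.evalEval w.1 w.2 := by
  simp only [evalEval_eq_eval_map, eval_map, eval₂_eq_sum, Polynomial.sum_def, coe_evalRingHom]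
  fun_prop

lemma tendsto_evalEval (G : ℝ[X][X]) {ι : Type*} {l : Filter ι} {t s : ι → ℝ} {a b : ℝ}
    (ht : Tendsto t l (𝓝 a)) (hs : Tendsto s l (𝓝 b)) :
    Tendsto (fun i => G.evalEval (t i) (s i)) l (𝓝 (G.evalEval a b)) :=
  ((continuous_evalEval G).tendsto (a, b)).comp (ht.prodMk_nhds hs)

lemma evalEval_zero_right (G : ℝ[X][X]) (t : ℝ) : G.evalEval t 0 = (G.coeff 0).eval t := by
  rw [evalEval, C_0, coeff_zero_eq_eval_zero]

lemma evalEval_taylor (G : ℝ[X][X]) (h : ℝ[X]) (t v : ℝ) :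
    (taylor h G).evalEval t v = G.evalEval t (v + h.eval t) := by
  rw [evalEval, taylor_eval, eval_eval_eq_evalEval]
  simp

/-- Approximate solution of `H(t, h(t)) = 0` by a polynomial `h` at a simple root. -/
lemma exists_polynomial_approx_root (H : ℝ[X][X]) (h0 : H.evalEval 0 0 = 0)
    (h1 : H.derivative.evalEval 0 0 ≠ 0) (M : ℕ) :
    ∃ h : ℝ[X], h.eval 0 = 0 ∧ X ^ M ∣ H.eval h := by
  suffices ∀ n : ℕ, ∃ h : ℝ[X], h.eval 0 = 0 ∧ X ^ (n + 1) ∣ H.eval h by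
    obtain ⟨h, hh, hd⟩ := this M
    exact ⟨h, hh, (pow_dvd_pow _ (Nat.le_succ M)).trans hd⟩
  intro n
  induction n with
  | zero =>
    refine ⟨0, eval_zero, ?_⟩
    rw [zero_add, pow_one, X_dvd_iff, coeff_zero_eq_eval_zero, eval_eval_eq_evalEval, eval_zero]
    exact h0
  | succ n ih =>
    obtain ⟨h, hh, g, hg⟩ := ih
    set δ := H.derivative.evalEval 0 0 with hδ
    -- Newton's step: `c` cancels the coefficient of `X ^ (n + 1)` in `H(h)`, and the quadratic
    -- remainder has order at least `2 * n + 2`.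
    set c := -g.eval 0 / δ with hc
    refine ⟨h + C c * X ^ (n + 1), by simp [hh], ?_⟩
    obtain ⟨k, hk⟩ := binomExpansion H h (C c * X ^ (n + 1))
    have h2 : X ∣ g + H.derivative.eval h * C c := by
      rw [X_dvd_iff, coeff_zero_eq_eval_zero, eval_add, eval_mul, eval_eval_eq_evalEval, hh,
        eval_C, ← hδ, hc]
      field_simp
      ring
    obtain ⟨g', hg'⟩ := h2
    rw [hk, hg]
    refine ⟨g' + k * C c ^ 2 * X ^ n, ?_⟩
    have : g = X * g' - H.derivative.eval h * C c := by rw [← hg']; ring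
    rw [this]
    ring

/-- A bound for the roots of a real polynomial equation with dominant top term. -/
lemma abs_root_le {n : ℕ} {w α δ K : ℝ} {b : ℕ → ℝ} (hδ : 0 < δ) (hα : δ ≤ |α|)
    (hb : ∀ j ∈ Finset.range (n + 1), |b j| ≤ K)
    (h : α * w ^ (n + 1) + ∑ j ∈ Finset.range (n + 1), b j * w ^ j = 0) :
    |w| ≤ max 1 ((n + 1) * K / δ) := by
  by_cases hw : |w| ≤ 1
  · exact hw.trans (le_max_left _ _)
  push Not at hw
  refine le_trans ?_ (le_max_right _ _)
  have hpos : 0 < |w| ^ n := by positivity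
  have h1 : |α| * |w| ^ (n + 1) ≤ (n + 1) * (K * |w| ^ n) := by
    calc |α| * |w| ^ (n + 1) = |∑ j ∈ Finset.range (n + 1), b j * w ^ j| := by
          rw [← abs_pow, ← abs_mul, eq_neg_of_add_eq_zero_left h, abs_neg]
      _ ≤ ∑ j ∈ Finset.range (n + 1), |b j * w ^ j| := Finset.abs_sum_le_sum_abs _ _
      _ ≤ ∑ j ∈ Finset.range (n + 1), K * |w| ^ n := by
          refine Finset.sum_le_sum fun j hj => ?_
          rw [abs_mul, abs_pow]
          have := hb j hj
          have hj' : j ≤ n := Nat.lt_succ_iff.mp (Finset.mem_range.mp hj)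
          have : |w| ^ j ≤ |w| ^ n := pow_le_pow_right₀ hw.le hj'
          have : 0 ≤ K := (abs_nonneg _).trans (hb j hj)
          gcongr
      _ = (n + 1) * (K * |w| ^ n) := by simp
  rw [le_div_iff₀ hδ]
  refine le_of_mul_le_mul_right ?_ hpos
  calc |w| * δ * |w| ^ n = δ * |w| ^ (n + 1) := by ring
    _ ≤ |α| * |w| ^ (n + 1) := by gcongr
    _ ≤ _ := h1
    _ = _ := by ring

/-- The weighted blow-up `t = τ ^ m`, `v = τ ^ k * w` of a polynomial. -/
lemma exists_weighted_blowup (G : ℝ[X][X]) {m k μ : ℕ}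
    (hG : ∀ j < μ, X ^ (k * (μ - j)) ∣ expand ℝ m (G.coeff j)) :
    ∃ G₁ : ℝ[X][X],
      (∀ τ w : ℝ, τ ^ (k * μ) * G₁.evalEval τ w = G.evalEval (τ ^ m) (τ ^ k * w)) ∧
      (∀ j < μ, expand ℝ m (G.coeff j) = X ^ (k * (μ - j)) * G₁.coeff j) ∧
      (∀ j, μ ≤ j → G₁.coeff j = X ^ (k * (j - μ)) * expand ℝ m (G.coeff j)) := by
  let F : ℝ[X][X] := (G.map (expand ℝ m : ℝ[X] →ₐ[ℝ] ℝ[X]).toRingHom).comp (C (X ^ k) * X)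
  have hF : ∀ j, F.coeff j = expand ℝ m (G.coeff j) * X ^ (k * j) := by
    intro j
    simp only [F, comp_C_mul_X_coeff, coeff_map, pow_mul]
    rfl
  -- Coefficients of index below `μ` are divisible by the hypothesis `hG`, the others because `k * j
  -- ≥ k * μ`.
  have hdvd : C (X ^ (k * μ)) ∣ F := by
    rw [C_dvd_iff_dvd_coeff]
    intro j
    rw [hF]
    rcases lt_or_ge j μ with hj | hj
    · have : k * μ = k * (μ - j) + k * j := by rw [← mul_add, Nat.sub_add_cancel hj.le]
      rw [this, pow_add]
      exact mul_dvd_mul_right (hG j hj) _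
    · exact (pow_dvd_pow _ (Nat.mul_le_mul_left k hj)).mul_left _
  obtain ⟨G₁, hG₁⟩ := hdvd
  have hX : ∀ n : ℕ, (X ^ n : ℝ[X]) ≠ 0 := fun n => pow_ne_zero _ X_ne_zero
  have hcoeff : ∀ j, X ^ (k * μ) * G₁.coeff j = expand ℝ m (G.coeff j) * X ^ (k * j) := by
    intro j
    rw [← hF, hG₁, coeff_C_mul]
  refine ⟨G₁, fun τ w => ?_, fun j hj => ?_, fun j hj => ?_⟩
  · have h1 : F.evalEval τ w = G.evalEval (τ ^ m) (τ ^ k * w) := by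
      simp only [F, evalEval_eq_eval_map, Polynomial.map_comp, Polynomial.map_map, eval_comp]
      have : (evalRingHom τ).comp (expand ℝ m : ℝ[X] →ₐ[ℝ] ℝ[X]).toRingHom
          = evalRingHom (τ ^ m) := by
        ext <;> simp
      rw [this]
      simp
    rw [← h1, hG₁, evalEval_mul, evalEval_C, eval_pow, eval_X]
  · refine mul_left_cancel₀ (hX (k * j)) ?_
    have : k * μ = k * j + k * (μ - j) := by rw [← mul_add, Nat.add_sub_cancel' hj.le]
    have h2 := hcoeff j
    rw [this, pow_add] at h2
    linear_combination -h2
  · refine mul_left_cancel₀ (hX (k * μ)) ?_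
    have : k * j = k * μ + k * (j - μ) := by rw [← mul_add, Nat.add_sub_cancel' hj]
    have h2 := hcoeff j
    rw [this, pow_add] at h2
    linear_combination h2

/-- All terms of degree at least `μ` in `v` go into `A`, which is close to `(G.coeff μ).eval 0` near
the origin. Small roots thus satisfy an equation of degree `μ` whose top coefficient stays away from
zero. -/
lemma exists_truncation (G : ℝ[X][X]) (μ : ℕ) :
    ∃ A : ℝ[X][X], A.coeff 0 = G.coeff μ ∧
      ∀ t v : ℝ, G.evalEval t v =
        A.evalEval t v * v ^ μ + ∑ j ∈ Finset.range μ, (G.coeff j).eval t * v ^ j := by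
  have hdvd : X ^ μ ∣ G - ∑ j ∈ Finset.range μ, C (G.coeff j) * X ^ j := by
    rw [X_pow_dvd_iff]
    intro i hi
    simp [coeff_C_mul, coeff_X_pow, hi]
  obtain ⟨A, hA⟩ := hdvd
  have hG : G = X ^ μ * A + ∑ j ∈ Finset.range μ, C (G.coeff j) * X ^ j := by rw [← hA]; ring
  refine ⟨A, ?_, fun t v => ?_⟩
  · have h1 := congrArg (fun P => coeff P μ) hA
    have h2 : (X ^ μ * A).coeff μ = A.coeff 0 := by simpa using coeff_X_pow_mul A μ 0
    simp only [coeff_sub, finsetSum_coeff, coeff_C_mul, coeff_X_pow, h2] at h1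
    rw [← h1, Finset.sum_eq_zero, sub_zero]
    intro j hj
    have : μ ≠ j := (Finset.mem_range.mp hj).ne'
    simp [this]
  · conv_lhs => rw [hG]
    simp only [evalEval_add, evalEval_mul, evalEval_pow, evalEval_X, evalEval_finsetSum,
      evalEval_C]
    ring

/-- Roots of `G` are bounded in the coordinates of a weighted blow-up that lies on or above the Newton
polygon. -/
lemma exists_bound_of_weighted_blowup {ι : Type*} {l : Filter ι} (G : ℝ[X][X]) {m k ν : ℕ}
    (hm : m ≠ 0) (hG : ∀ j < ν + 1, X ^ (k * (ν + 1 - j)) ∣ expand ℝ m (G.coeff j))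
    (hμ : (G.coeff (ν + 1)).eval 0 ≠ 0) {τ w : ι → ℝ} (hτ : ∀ᶠ i in l, 0 < τ i)
    (hτ0 : Tendsto τ l (𝓝 0)) (hv : Tendsto (fun i => τ i ^ k * w i) l (𝓝 0))
    (hroot : ∀ᶠ i in l, G.evalEval (τ i ^ m) (τ i ^ k * w i) = 0) :
    ∃ K, ∀ᶠ i in l, |w i| ≤ K := by
  obtain ⟨A, hA0, hA⟩ := exists_truncation G (ν + 1)
  choose! b hb using hG
  have ht : Tendsto (fun i => τ i ^ m) l (𝓝 0) := by simpa [hm] using hτ0.pow m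
  have hAlim : Tendsto (fun i => |A.evalEval (τ i ^ m) (τ i ^ k * w i)|) l
      (𝓝 |(G.coeff (ν + 1)).eval 0|) := by
    have := (tendsto_evalEval A ht hv).abs
    rwa [evalEval_zero_right, hA0] at this
  set a := |(G.coeff (ν + 1)).eval 0| with ha
  have hapos : 0 < a := abs_pos.mpr hμ
  have hbb : ∀ j ∈ Finset.range (ν + 1), ∀ᶠ i in l,
      |(b j).eval (τ i)| ≤ ∑ j ∈ Finset.range (ν + 1), (|(b j).eval 0| + 1) := by
    intro j hj
    have h1 : Tendsto (fun i => |(b j).eval (τ i)|) l (𝓝 |(b j).eval 0|) :=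
      (((b j).continuous.tendsto 0).comp hτ0).abs
    filter_upwards [h1.eventually (gt_mem_nhds (lt_add_one _))] with i hi
    exact hi.le.trans (Finset.single_le_sum (f := fun j => |(b j).eval 0| + 1)
      (fun j _ => by positivity) hj)
  set S := ∑ j ∈ Finset.range (ν + 1), (|(b j).eval 0| + 1) with hS
  refine ⟨max 1 ((ν + 1) * S / (a / 2)), ?_⟩
  filter_upwards [hτ, hroot, hAlim.eventually (lt_mem_nhds (half_lt_self hapos)),
    (Filter.eventually_all_finset _).mpr hbb] with i hτi hi hAi hbi
  refine abs_root_le (half_pos hapos) hAi.le hbi ?_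
  rw [hA] at hi
  -- Division of the equation by this power leaves top coefficient `A` and bounded lower
  -- coefficients `b j`, as `abs_root_le` requires.
  have hpos : τ i ^ (k * (ν + 1)) ≠ 0 := (pow_pos hτi _).ne'
  refine (mul_eq_zero.mp ?_).resolve_left hpos
  rw [← hi, mul_add, Finset.mul_sum]
  congr 1
  · rw [mul_pow, ← pow_mul]; ring
  · refine Finset.sum_congr rfl fun j hj => ?_
    have hj' := Finset.mem_range.mp hj
    have h2 := congrArg (eval (τ i)) (hb j hj')
    rw [expand_eval, eval_mul, eval_pow, eval_X] at h2
    have h3 : k * (ν + 1) = k * (ν + 1 - j) + k * j := by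
      rw [← mul_add, Nat.sub_add_cancel hj'.le]
    rw [h2, h3, pow_add, mul_pow, ← pow_mul]
    ring

/-- The first slope of the Newton polygon, if it is less than `M`. -/
lemma exists_newton_slope (G : ℝ[X][X]) {ν M : ℕ}
    (h0 : ∀ j < ν + 1, (G.coeff j).eval 0 = 0)
    (hM : ∃ j < ν + 1, ¬ X ^ (M * (ν + 1 - j)) ∣ G.coeff j) :
    ∃ m k j₀ : ℕ, m ≠ 0 ∧ k ≠ 0 ∧ j₀ < ν + 1 ∧ k < m * M ∧
      (∀ j < ν + 1, X ^ (k * (ν + 1 - j)) ∣ expand ℝ m (G.coeff j)) ∧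
      ¬ X ^ (k * (ν + 1 - j₀) + 1) ∣ expand ℝ m (G.coeff j₀) := by
  classical
  have hfac : ∀ j, ∃ (n : ℕ) (s : ℝ[X]), G.coeff j ≠ 0 → s.eval 0 ≠ 0 ∧ G.coeff j = X ^ n * s := by
    intro j
    by_cases hj : G.coeff j = 0
    · exact ⟨0, 0, fun h => absurd hj h⟩
    · obtain ⟨n, s, hs⟩ := exists_eq_X_pow_mul hj
      exact ⟨n, s, fun _ => hs⟩
  choose e s hs using hfac
  obtain ⟨j₁, hj₁, hnd⟩ := hM
  have hj₁0 : G.coeff j₁ ≠ 0 := fun h => hnd (h ▸ dvd_zero _)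
  obtain ⟨j₀, hj₀, hmin⟩ := Finset.exists_min_image
    ((Finset.range (ν + 1)).filter fun j => G.coeff j ≠ 0)
    (fun j => (e j : ℚ) / ((ν + 1 - j : ℕ) : ℚ)) ⟨j₁, by simp [hj₁, hj₁0]⟩
  simp only [Finset.mem_filter, Finset.mem_range] at hj₀ hmin
  have hcross : ∀ j < ν + 1, G.coeff j ≠ 0 → e j₀ * (ν + 1 - j) ≤ (ν + 1 - j₀) * e j := by
    intro j hj hj0
    have h1 := hmin j ⟨hj, hj0⟩
    have hp : (0 : ℚ) < ((ν + 1 - j : ℕ) : ℚ) := by exact_mod_cast Nat.sub_pos_of_lt hj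
    have hp0 : (0 : ℚ) < ((ν + 1 - j₀ : ℕ) : ℚ) := by exact_mod_cast Nat.sub_pos_of_lt hj₀.1
    rw [div_le_div_iff₀ hp0 hp] at h1
    rw [mul_comm (ν + 1 - j₀)]
    exact_mod_cast h1
  have hexp : ∀ j, G.coeff j ≠ 0 → ∀ m : ℕ,
      expand ℝ m (G.coeff j) = X ^ (m * e j) * expand ℝ m (s j) := by
    intro j hj m
    conv_lhs => rw [(hs j hj).2]
    rw [map_mul, map_pow, expand_X, pow_mul]
  -- The minimal slope is `k / m = e j₀ / (ν + 1 - j₀)`, not necessarily in lowest terms; the index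
  -- `j₀` gives a point on the edge itself.
  refine ⟨ν + 1 - j₀, e j₀, j₀, (Nat.sub_pos_of_lt hj₀.1).ne', ?_, hj₀.1, ?_, ?_, ?_⟩
  · intro he
    have h1 := hs j₀ hj₀.2
    have h2 := h0 j₀ hj₀.1
    rw [h1.2, he, pow_zero, one_mul] at h2
    exact h1.1 h2
  · have h1 := hcross j₁ hj₁ hj₁0
    have h2 : e j₁ < M * (ν + 1 - j₁) := by
      by_contra! hle
      refine hnd ?_
      rw [(hs j₁ hj₁0).2]
      exact (pow_dvd_pow _ hle).mul_right _
    have hp0 := Nat.sub_pos_of_lt hj₀.1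
    have h3 := lt_of_le_of_lt h1 (Nat.mul_lt_mul_of_pos_left h2 hp0)
    rw [← mul_assoc] at h3
    exact lt_of_mul_lt_mul_right h3 (Nat.zero_le _)
  · intro j hj
    by_cases hj0 : G.coeff j = 0
    · rw [hj0, map_zero]
      exact dvd_zero _
    · rw [hexp j hj0]
      exact (pow_dvd_pow _ (hcross j hj hj0)).mul_right _
  · rw [hexp j₀ hj₀.2, mul_comm (e j₀), pow_succ]
    intro hd
    have h1 := (mul_dvd_mul_iff_left (pow_ne_zero _ X_ne_zero)).mp hd
    rw [X_dvd_iff, coeff_zero_eq_eval_zero, expand_eval,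
      zero_pow (Nat.sub_pos_of_lt hj₀.1).ne'] at h1
    exact (hs j₀ hj₀.2).1 h1

/-- `s` agrees, up to `O(t ^ M)`, with a polynomial in a root of `t`. -/
def PuiseuxApprox {ι : Type*} (l : Filter ι) (t s : ι → ℝ) (M : ℕ) : Prop :=
  ∃ (m : ℕ) (h : ℝ[X]), m ≠ 0 ∧
    (fun i => s i - h.eval (t i ^ ((m : ℝ)⁻¹))) =O[l] fun i => t i ^ M

/-- All small roots `s` of polynomials `G` with `G(0, s)` of order `μ` have approximations of every
order. -/
def RootsApproximable {ι : Type*} (l : Filter ι) (μ : ℕ) : Prop :=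
  ∀ (G : ℝ[X][X]) (t s : ι → ℝ) (M : ℕ), (∀ᶠ i in l, 0 < t i) → Tendsto t l (𝓝 0) →
    Tendsto s l (𝓝 0) → (∀ᶠ i in l, G.evalEval (t i) (s i) = 0) →
    (∀ j < μ, (G.coeff j).eval 0 = 0) → (G.coeff μ).eval 0 ≠ 0 → PuiseuxApprox l t s M

lemma PuiseuxApprox.add_polynomial {ι : Type*} {l : Filter ι} {t s : ι → ℝ} {M : ℕ}
    (hs : PuiseuxApprox l t s M) (ht : ∀ᶠ i in l, 0 < t i) (h : ℝ[X]) :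
    PuiseuxApprox l t (fun i => s i + h.eval (t i)) M := by
  obtain ⟨m, g, hm, hg⟩ := hs
  refine ⟨m, g + expand ℝ m h, hm, hg.congr' ?_ EventuallyEq.rfl⟩
  filter_upwards [ht] with i hi
  rw [eval_add, expand_eval, Real.rpow_inv_natCast_pow hi.le hm]
  ring

/-- Transfer of an approximation through the weighted blow-up `t = τ ^ m`, `s = τ ^ k * (c + w)`. -/
lemma PuiseuxApprox.of_weighted_blowup {ι : Type*} {l : Filter ι} {t s w : ι → ℝ} {m k M : ℕ}
    {c : ℝ} (hm : m ≠ 0) (ht : ∀ᶠ i in l, 0 < t i) (ht0 : Tendsto t l (𝓝 0))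
    (hs : ∀ᶠ i in l, s i = (t i ^ ((m : ℝ)⁻¹)) ^ k * (c + w i))
    (hw : PuiseuxApprox l (fun i => t i ^ ((m : ℝ)⁻¹)) w (m * M)) :
    PuiseuxApprox l t s M := by
  obtain ⟨n, g, hn, hg⟩ := hw
  -- With `ρ = t ^ (1 / (m * n))` one has `τ = ρ ^ n`, so `τ ^ k * (c + g(ρ))` is a polynomial in
  -- `ρ`; the error is `O(τ ^ (m * M)) = O(t ^ M)`.
  refine ⟨m * n, X ^ (n * k) * (C c + g), mul_ne_zero hm hn, ?_⟩
  have hbdd : (fun i => (t i ^ ((m : ℝ)⁻¹)) ^ k) =O[l] fun _ => (1 : ℝ) := by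
    have h1 : Tendsto (fun i => (t i ^ ((m : ℝ)⁻¹)) ^ k) l (𝓝 ((0 ^ ((m : ℝ)⁻¹)) ^ k)) :=
      (ht0.rpow_const (Or.inr (by positivity))).pow k
    exact h1.isBigO_one ℝ
  refine (hbdd.mul hg).congr' ?_ ?_
  · filter_upwards [ht, hs] with i hi hsi
    have h1 : t i ^ (((m * n : ℕ) : ℝ)⁻¹) = (t i ^ ((m : ℝ)⁻¹)) ^ ((n : ℝ)⁻¹) := by
      rw [← Real.rpow_mul hi.le]
      congr 1
      push_cast
      rw [mul_inv]
    rw [h1, hsi]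
    simp only [eval_mul, eval_pow, eval_X, eval_add, eval_C]
    rw [pow_mul, Real.rpow_inv_natCast_pow (Real.rpow_nonneg hi.le _) hn]
    ring
  · filter_upwards [ht] with i hi
    rw [one_mul, pow_mul, Real.rpow_inv_natCast_pow hi.le hm]

/-- Setting `t = 0` commutes with a constant translation, so the order of the translated polynomial
on `t = 0` can be read off in one variable. -/
lemma eval_zero_coeff_taylor_C (G : ℝ[X][X]) (c : ℝ) (j : ℕ) :
    ((taylor (C c) G).coeff j).eval 0 = (taylor c (G.map (evalRingHom 0))).coeff j := by
  rw [taylor_coeff, taylor_coeff, eval_eval_eq_evalEval, evalEval_eq_eval_map]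
  congr 1
  · simp
  · ext n
    simp [hasseDeriv_coeff]

/-- A polynomial of degree `ν + 1` without term of degree `ν` that is not a monomial has no root of
multiplicity `ν + 1`. -/
lemma exists_coeff_taylor_ne_zero {β : ℝ[X]} {ν j₀ : ℕ} (c : ℝ) (hdeg : β.natDegree ≤ ν + 1)
    (hlead : β.coeff (ν + 1) ≠ 0) (hν : β.coeff ν = 0) (hj₀ : j₀ < ν + 1)
    (hβ : β.coeff j₀ ≠ 0) : ∃ j < ν + 1, (taylor c β).coeff j ≠ 0 := by
  by_contra! hall
  -- The Taylor coefficient of index `ν` at `c` is `(ν + 1) * c` times the leading coefficient; its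
  -- vanishing forces `c = 0`, and then `hall` contradicts `hβ`.
  have h1 := hall ν (Nat.lt_succ_self ν)
  have hd : (hasseDeriv ν β).natDegree ≤ 1 := (natDegree_hasseDeriv_le β ν).trans (by omega)
  rw [taylor_coeff, eq_X_add_C_of_natDegree_le_one hd] at h1
  simp only [hasseDeriv_coeff, eval_add, eval_mul, eval_C, eval_X, zero_add, hν, mul_zero,
    add_zero, add_comm 1 ν] at h1
  have hc : c = 0 := by
    refine (mul_eq_zero.mp h1).resolve_left (mul_ne_zero ?_ hlead)
    exact_mod_cast (Nat.choose_pos (Nat.le_succ ν)).ne'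
  subst hc
  exact hβ (by simpa using hall j₀ hj₀)

/-- Compactness; working along an ultrafilter spares every passage to a subsequence in the
algorithm. -/
lemma exists_tendsto_of_bounded {ι : Type*} (U : Ultrafilter ι) {w : ι → ℝ} {K : ℝ}
    (hw : ∀ᶠ i in U, |w i| ≤ K) : ∃ c, Tendsto w U (𝓝 c) := by
  obtain ⟨c, -, hc⟩ := (isCompact_Icc (a := -K) (b := K)).ultrafilter_le_nhds (U.map w) (by
    rw [le_principal_iff]
    exact hw.mono fun i hi => abs_le.mp hi)
  exact ⟨c, hc⟩

lemma exists_first_coeff_ne_zero {a : ℕ → ℝ} {n : ℕ} (h : ∃ j < n, a j ≠ 0) :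
    ∃ j < n, (∀ i < j, a i = 0) ∧ a j ≠ 0 := by
  classical
  obtain ⟨j, hj, hne⟩ := h
  have hex : ∃ j, a j ≠ 0 := ⟨j, hne⟩
  exact ⟨Nat.find hex, (Nat.find_min' hex hne).trans_lt hj,
    fun i hi => not_not.mp (Nat.find_min hex hi), Nat.find_spec hex⟩

/-- The inductive step of the Newton–Puiseux algorithm, for a polynomial whose coefficient next to the
dominant one is negligible. -/
lemma puiseuxApprox_of_dvd_coeff {ι : Type*} (U : Ultrafilter ι) {ν : ℕ}
    (ih : ∀ μ < ν + 1, RootsApproximable (U : Filter ι) μ) (G : ℝ[X][X]) (t v : ι → ℝ) (M : ℕ)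
    (ht : ∀ᶠ i in U, 0 < t i) (ht0 : Tendsto t U (𝓝 0)) (hv0 : Tendsto v U (𝓝 0))
    (hroot : ∀ᶠ i in U, G.evalEval (t i) (v i) = 0) (hlow : ∀ j < ν + 1, (G.coeff j).eval 0 = 0)
    (hlead : (G.coeff (ν + 1)).eval 0 ≠ 0) (hν : X ^ M ∣ G.coeff ν) :
    PuiseuxApprox (U : Filter ι) t v M := by
  have hbound : ∀ m k : ℕ, m ≠ 0 →
      (∀ j < ν + 1, X ^ (k * (ν + 1 - j)) ∣ expand ℝ m (G.coeff j)) →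
      ∃ K, ∀ᶠ i in U, |v i / (t i ^ ((m : ℝ)⁻¹)) ^ k| ≤ K := by
    intro m k hm hdvd
    have hcancel : ∀ᶠ i in U, (t i ^ ((m : ℝ)⁻¹)) ^ k * (v i / (t i ^ ((m : ℝ)⁻¹)) ^ k) = v i := by
      filter_upwards [ht] with i hi
      exact mul_div_cancel₀ _ (pow_pos (Real.rpow_pos_of_pos hi _) _).ne'
    refine exists_bound_of_weighted_blowup G hm hdvd hlead (τ := fun i => t i ^ ((m : ℝ)⁻¹))
      (ht.mono fun i hi => Real.rpow_pos_of_pos hi _) ?_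
      (hv0.congr' (hcancel.mono fun i hi => hi.symm)) ?_
    · have := ht0.rpow_const (p := (m : ℝ)⁻¹) (Or.inr (by positivity))
      rwa [Real.zero_rpow (by positivity)] at this
    · filter_upwards [ht, hcancel, hroot] with i hi hci hri
      rw [hci, Real.rpow_inv_natCast_pow hi.le hm, hri]
  -- Either the Newton polygon has a slope below `M`, and a blow-up along it lowers the order, or
  -- all points lie on or above the line of slope `M`; then `v = O(t ^ M)` and the approximation is
  -- `0`.
  by_cases hM : ∃ j < ν + 1, ¬ X ^ (M * (ν + 1 - j)) ∣ G.coeff j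
  · obtain ⟨m, k, j₀, hm, hk, hj₀, hkM, hdvd, hnd⟩ := exists_newton_slope G hlow hM
    obtain ⟨K, hK⟩ := hbound m k hm hdvd
    obtain ⟨c, hc⟩ := exists_tendsto_of_bounded U hK
    obtain ⟨G₁, hG₁, hG₁low, hG₁high⟩ := exists_weighted_blowup G hdvd
    set τ : ι → ℝ := fun i => t i ^ ((m : ℝ)⁻¹) with hτ
    set β := G₁.map (evalRingHom 0) with hβ
    have hτpos : ∀ᶠ i in U, 0 < τ i := ht.mono fun i hi => Real.rpow_pos_of_pos hi _
    have hτ0 : Tendsto τ U (𝓝 0) := by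
      have := ht0.rpow_const (p := (m : ℝ)⁻¹) (Or.inr (by positivity))
      rwa [Real.zero_rpow (by positivity)] at this
    have hβcoeff : ∀ j, β.coeff j = (G₁.coeff j).eval 0 := fun j => by simp [hβ]
    have hβlead : β.coeff (ν + 1) ≠ 0 := by
      rw [hβcoeff, hG₁high _ le_rfl]
      simpa [expand_eval, zero_pow hm] using hlead
    have hβdeg : β.natDegree ≤ ν + 1 := by
      refine natDegree_le_iff_coeff_eq_zero.mpr fun j hj => ?_
      have : k * (j - (ν + 1)) ≠ 0 := mul_ne_zero hk (Nat.sub_pos_of_lt hj).ne'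
      rw [hβcoeff, hG₁high _ (le_of_lt hj)]
      simp [zero_pow this]
    -- The coefficient of index `ν` is divisible by `τ ^ (m * M)`, while the blow-up removes only `τ
    -- ^ k` with `k < m * M`.
    have hβν : β.coeff ν = 0 := by
      have h1 := hG₁low ν (Nat.lt_succ_self ν)
      obtain ⟨b, hb⟩ := hν
      rw [hb, map_mul, map_pow, expand_X, ← pow_mul, Nat.add_sub_cancel_left, mul_one] at h1
      obtain ⟨n, hn⟩ := Nat.exists_eq_add_of_lt hkM
      have h2 : G₁.coeff ν = X ^ (n + 1) * expand ℝ m b := by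
        refine mul_left_cancel₀ (pow_ne_zero k (X_ne_zero (R := ℝ))) ?_
        rw [← h1, hn]
        ring
      rw [hβcoeff, h2]
      simp
    have hβj₀ : β.coeff j₀ ≠ 0 := by
      intro h
      refine hnd ?_
      rw [hβcoeff, ← coeff_zero_eq_eval_zero, ← X_dvd_iff] at h
      rw [hG₁low j₀ hj₀, pow_succ]
      exact mul_dvd_mul_left _ h
    -- Here `μ` is the multiplicity of the limit `c` as a root of `β`; it is at most `ν`, which
    -- makes the induction descend.
    obtain ⟨μ, hμ, hμlow, hμne⟩ := exists_first_coeff_ne_zero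
      (exists_coeff_taylor_ne_zero c hβdeg hβlead hβν hj₀ hβj₀)
    refine PuiseuxApprox.of_weighted_blowup (k := k) (c := c)
      (w := fun i => v i / τ i ^ k - c) hm ht ht0 ?_
      (ih μ hμ (taylor (C c) G₁) τ _ (m * M) hτpos hτ0 ?_ ?_ ?_ ?_)
    · filter_upwards [hτpos] with i hi
      rw [add_sub_cancel, mul_div_cancel₀ _ (pow_pos hi _).ne']
    · simpa using hc.sub_const c
    · filter_upwards [ht, hτpos, hroot] with i hi hτi hri
      rw [evalEval_taylor, eval_C, sub_add_cancel]
      have h1 := hG₁ (τ i) (v i / τ i ^ k)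
      rw [mul_div_cancel₀ _ (pow_pos hτi _).ne', hτ, Real.rpow_inv_natCast_pow hi.le hm, hri] at h1
      exact (mul_eq_zero.mp h1).resolve_left (pow_pos hτi _).ne'
    · intro j hj
      rw [eval_zero_coeff_taylor_C]
      exact hμlow j hj
    · rw [eval_zero_coeff_taylor_C]
      exact hμne
  · push Not at hM
    obtain ⟨K, hK⟩ := hbound 1 M one_ne_zero (by simpa using hM)
    refine ⟨1, 0, one_ne_zero, IsBigO.of_bound K ?_⟩
    filter_upwards [ht, hK] with i hi hKi
    simp only [Nat.cast_one, inv_one, Real.rpow_one, eval_zero, sub_zero, Real.norm_eq_abs,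
      abs_div] at hKi ⊢
    rwa [div_le_iff₀ (by positivity)] at hKi

/-- Strong induction on the order `μ`. For `μ = 0` there are no small roots. Otherwise a Tschirnhaus
translation makes the coefficient of index `μ - 1` negligible, so that the next blow-up must lower
the order. -/
theorem rootsApproximable {ι : Type*} (U : Ultrafilter ι) (μ : ℕ) :
    RootsApproximable (U : Filter ι) μ := by
  induction μ using Nat.strong_induction_on with
  | _ μ ih =>
  intro G t s M ht ht0 hs0 hroot hlow hlead
  rcases μ with _ | ν
  · have h1 := tendsto_evalEval G ht0 hs0
    rw [evalEval_zero_right] at h1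
    obtain ⟨i, hi, hi'⟩ := ((h1.eventually_ne hlead).and hroot).exists
    exact absurd hi' hi
  -- After translation by `h` the coefficient of index `ν` is `(hasseDeriv ν G)(h)`. Since
  -- `hasseDeriv ν G` has a simple root at the origin, some polynomial `h` makes this divisible by
  -- `X ^ M`.
  · have hH0 : (hasseDeriv ν G).evalEval 0 0 = 0 := by
      rw [evalEval_zero_right, hasseDeriv_coeff]
      simp [hlow ν (Nat.lt_succ_self ν)]
    have hH1 : (derivative (hasseDeriv ν G)).evalEval 0 0 ≠ 0 := by
      rw [evalEval_zero_right, coeff_derivative, hasseDeriv_coeff]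
      simp [add_comm 1 ν, hlead]
      exact_mod_cast Nat.succ_ne_zero ν
    obtain ⟨h, hh, hdvd⟩ := exists_polynomial_approx_root _ hH0 hH1 M
    have hcoeff : ∀ j, ((taylor h G).coeff j).eval 0 = (G.coeff j).eval 0 := by
      intro j
      rw [taylor_coeff, eval_eval_eq_evalEval, hh, evalEval_zero_right, hasseDeriv_coeff]
      simp
    have hstep := puiseuxApprox_of_dvd_coeff U ih (taylor h G) t (fun i => s i - h.eval (t i)) M
      ht ht0 ?_ ?_ (fun j hj => (hcoeff j).trans (hlow j hj)) (by rwa [hcoeff])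
      (by rwa [taylor_coeff])
    · simpa using hstep.add_polynomial ht h
    · have h1 := hs0.sub ((h.continuous.tendsto 0).comp ht0)
      simpa [hh] using h1
    · filter_upwards [hroot] with i hi
      rw [evalEval_taylor, sub_add_cancel, hi]

/-- Bounded roots of a nonzero polynomial `G(t, ·)` are, as `t → 0+`, approximated to any order by
polynomials in a root of `t`. -/
theorem puiseuxApprox_of_root {ι : Type*} (U : Ultrafilter ι) {G : ℝ[X][X]} (hG : G ≠ 0)
    {t s : ι → ℝ} {K : ℝ} (M : ℕ) (ht : ∀ᶠ i in U, 0 < t i) (ht0 : Tendsto t U (𝓝 0))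
    (hs : ∀ᶠ i in U, |s i| ≤ K) (hroot : ∀ᶠ i in U, G.evalEval (t i) (s i) = 0) :
    PuiseuxApprox (U : Filter ι) t s M := by
  obtain ⟨c, hc⟩ := exists_tendsto_of_bounded U hs
  -- Removing the factor `t ^ n` keeps the roots with `t > 0` and makes `G₀(0, ·)` nonzero, so it
  -- has a finite order at the limit `c`.
  obtain ⟨n, G₀, hG₀, rfl⟩ := WfDvdMonoid.max_power_factor hG
    (prime_C_iff.mpr (prime_X (R := ℝ))).irreducible
  have hβ : G₀.map (evalRingHom 0) ≠ 0 := by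
    intro h
    refine hG₀ ((C_dvd_iff_dvd_coeff _ _).mpr fun j => ?_)
    rw [X_dvd_iff, coeff_zero_eq_eval_zero]
    simpa using congrArg (fun P => coeff P j) h
  have hex : ∃ j, (taylor c (G₀.map (evalRingHom 0))).coeff j ≠ 0 := by
    by_contra! h
    exact hβ ((taylor_injective c) (by rw [map_zero]; exact Polynomial.ext h))
  obtain ⟨j, hj⟩ := hex
  obtain ⟨μ, -, hμlow, hμne⟩ := exists_first_coeff_ne_zero ⟨j, Nat.lt_succ_self j, hj⟩
  have h1 := rootsApproximable U μ (taylor (C c) G₀) t (fun i => s i - c) M ht ht0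
    (by simpa using hc.sub_const c) ?_ (fun j hj => by rw [eval_zero_coeff_taylor_C]; exact hμlow j hj)
    (by rw [eval_zero_coeff_taylor_C]; exact hμne)
  · simpa using h1.add_polynomial ht (C c)
  · filter_upwards [hroot, ht] with i hi hti
    rw [evalEval_taylor, eval_C, sub_add_cancel]
    rw [evalEval_mul, evalEval_pow, evalEval_C, eval_X] at hi
    exact (mul_eq_zero.mp hi).resolve_left (pow_pos hti _).ne'

/-! ### From a cone to a Puiseux curve -/

lemma hasDerivAt_evalEval (P : ℝ[X][X]) (u v : ℝ) :
    HasDerivAt (fun y => P.evalEval u y) (P.derivative.evalEval u v) v := by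
  simp only [evalEval_eq_eval_map, ← derivative_map]
  exact Polynomial.hasDerivAt _ _

lemma contDiff_evalEval (P : ℝ[X][X]) : ContDiff ℝ 1 fun w : ℝ × ℝ => P.evalEval w.1 w.2 := by
  simp only [evalEval_eq_eval_map, eval_map, eval₂_eq_sum, Polynomial.sum_def, coe_evalRingHom]
  have h : ∀ r : ℝ[X], ContDiff ℝ 1 fun t : ℝ => r.eval t := fun r => by
    simpa [coe_aeval_eq_eval] using r.contDiff_aeval (𝕜 := ℝ) 1
  exact ContDiff.sum fun j _ => ((h (P.coeff j)).comp contDiff_fst).mul (contDiff_snd.pow j)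

/-- On each vertical segment `|y| ≤ u` the minimum of `|P / Q|` is attained at a root of a fixed nonzero
polynomial. -/
lemma exists_root_abs_div_le (P Q : ℝ[X][X]) :
    ∃ F : ℝ[X][X], F ≠ 0 ∧ ∀ u v : ℝ, 0 < u → |v| ≤ u →
      (∀ y, |y| ≤ u → Q.evalEval u y ≠ 0) →
      ∃ y, |y| ≤ u ∧ F.evalEval u y = 0 ∧
        |P.evalEval u y / Q.evalEval u y| ≤ |P.evalEval u v / Q.evalEval u v| := by
  set W := derivative P * Q - P * derivative Q with hW
  have hderiv : ∀ u y : ℝ, Q.evalEval u y ≠ 0 →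
      HasDerivAt (fun y => P.evalEval u y / Q.evalEval u y)
        (W.evalEval u y / Q.evalEval u y ^ 2) y := by
    intro u y hy
    have := (hasDerivAt_evalEval P u y).div (hasDerivAt_evalEval Q u y) hy
    rwa [← evalEval_mul, ← evalEval_mul, ← evalEval_sub] at this
  have hB : (X ^ 2 - C (X ^ 2) : ℝ[X][X]) ≠ 0 := (monic_X_pow_sub_C _ two_ne_zero).ne_zero
  have hBeval : ∀ u y : ℝ, (X ^ 2 - C (X ^ 2) : ℝ[X][X]).evalEval u y = y ^ 2 - u ^ 2 := by
    intro u y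
    rw [evalEval_sub, evalEval_pow, evalEval_X, evalEval_C, eval_pow, eval_X]
  -- `W` is the numerator of the derivative of the quotient. If it is zero, the quotient is constant
  -- on each segment and the endpoint `y = u` will do.
  by_cases hW0 : W = 0
  · refine ⟨_, hB, fun u v hu hv hQ => ⟨u, (abs_of_pos hu).le, ?_, le_of_eq ?_⟩⟩
    · rw [hBeval, sub_self]
    · congr 1
      refine (convex_Icc (-u) u).is_const_of_fderivWithin_eq_zero (𝕜 := ℝ)
        (f := fun y => P.evalEval u y / Q.evalEval u y)
        (fun y hy => (hderiv u y (hQ y (abs_le.mpr hy))).differentiableAt.differentiableWithinAt)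
        (fun y hy => ?_) ⟨by linarith, le_rfl⟩ (abs_le.mp hv)
      have h1 := hderiv u y (hQ y (abs_le.mpr hy))
      rw [hW0, evalEval_zero, zero_div] at h1
      have h2 := h1.hasFDerivAt.hasFDerivWithinAt (s := Set.Icc (-u) u)
      rw [h2.fderivWithin (uniqueDiffOn_Icc (by linarith) y hy)]
      ext
      simp
  · have hP0 : P ≠ 0 := fun h => hW0 (by rw [hW, h]; simp)
    refine ⟨(X ^ 2 - C (X ^ 2)) * (P * W), mul_ne_zero hB (mul_ne_zero hP0 hW0),
      fun u v hu hv hQ => ?_⟩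
    set φ : ℝ → ℝ := fun y => P.evalEval u y / Q.evalEval u y with hφ
    -- The square is minimised because it is differentiable: at an interior minimum `φ * φ' = 0`,
    -- that is `P * W = 0`; the endpoints are the roots of `y ^ 2 - u ^ 2`.
    have hcont : ContinuousOn (fun y => φ y ^ 2) (Set.Icc (-u) u) := fun y hy =>
      ((hderiv u y (hQ y (abs_le.mpr hy))).continuousAt.pow 2).continuousWithinAt
    obtain ⟨y, hy, hmin⟩ := isCompact_Icc.exists_isMinOn ⟨v, abs_le.mp hv⟩ hcont
    have hyu := abs_le.mpr hy
    refine ⟨y, hyu, ?_, sq_le_sq.mp (hmin (abs_le.mp hv))⟩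
    rw [evalEval_mul, hBeval]
    rcases hyu.eq_or_lt with heq | hlt
    · rw [← sq_abs y, heq, sub_self, zero_mul]
    · have hloc : IsLocalMin (fun y => φ y ^ 2) y :=
        hmin.isLocalMin (Icc_mem_nhds (abs_lt.mp hlt).1 (abs_lt.mp hlt).2)
      have hd := (hderiv u y (hQ y hyu)).pow 2
      have h0 := hloc.hasDerivAt_eq_zero hd
      have hq := hQ y hyu
      have : P.evalEval u y * W.evalEval u y = 0 := by
        simp only [Nat.cast_ofNat, Nat.add_one_sub_one, pow_one] at h0
        field_simp at h0
        simpa using h0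
      rw [evalEval_mul, this, mul_zero]

/-- Boundedness of the first quotient leaves a single factor `1 / |q₂|`, so an error `δ` small
compared with `|q₂|` is enough. -/
lemma abs_div_sub_div_le {p₁ q₁ p₂ q₂ K δ : ℝ} (h₁ : q₁ ≠ 0) (h₂ : q₂ ≠ 0)
    (hK : |p₁| ≤ K * |q₁|) (hp : |p₁ - p₂| ≤ δ) (hq : |q₁ - q₂| ≤ δ) :
    |p₁ / q₁ - p₂ / q₂| ≤ (K + 1) * δ / |q₂| := by
  have h1 : p₁ / q₁ - p₂ / q₂ = ((p₁ / q₁) * (q₂ - q₁) + (p₁ - p₂)) / q₂ := by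
    field_simp
    ring
  have h2 : |p₁ / q₁| ≤ K := by
    rw [abs_div]
    exact (div_le_iff₀ (abs_pos.mpr h₁)).mpr hK
  rw [h1, abs_div]
  gcongr
  calc |p₁ / q₁ * (q₂ - q₁) + (p₁ - p₂)| ≤ |p₁ / q₁| * |q₂ - q₁| + |p₁ - p₂| := by
        rw [← abs_mul]; exact abs_add_le _ _
    _ ≤ K * δ + δ := by
        rw [abs_sub_comm] at hq
        have : 0 ≤ K := (abs_nonneg _).trans h2
        gcongr
    _ = (K + 1) * δ := by ring

/-- A cluster value at the origin of a bounded quotient `P / Q` in the cone `|v| ≤ u` is also a cluster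
value along a curve `v = u * h(u ^ (1 / m))` with a polynomial `h`. -/
theorem exists_curve_of_tendsto_in_cone {P Q : ℝ[X][X]} {r : ℝ[X]} {K K' : ℝ} (hr : r ≠ 0)
    (hPQ : ∀ᶠ w : ℝ × ℝ in 𝓝 0, |P.evalEval w.1 w.2| ≤ K * |Q.evalEval w.1 w.2|)
    (hrQ : ∀ᶠ w : ℝ × ℝ in 𝓝 0, |r.eval w.1| ≤ K' * |Q.evalEval w.1 w.2|)
    {l : Filter (ℝ × ℝ)} [l.NeBot] (hl : l ≤ 𝓝 0) (hcone : ∀ᶠ w in l, 0 < w.1 ∧ |w.2| ≤ w.1)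
    {d : ℝ} (hd : Tendsto (fun w => P.evalEval w.1 w.2 / Q.evalEval w.1 w.2) l (𝓝 d)) :
    ∃ (m : ℕ) (h : ℝ[X]) (l' : Filter ℝ), m ≠ 0 ∧ l'.NeBot ∧ l' ≤ 𝓝[>] 0 ∧
      Tendsto (fun u => P.evalEval u (u * h.eval (u ^ ((m : ℝ)⁻¹))) /
        Q.evalEval u (u * h.eval (u ^ ((m : ℝ)⁻¹)))) l' (𝓝 d) := by
  let U : Ultrafilter (ℝ × ℝ) := Ultrafilter.of l
  have hUl : (U : Filter (ℝ × ℝ)) ≤ l := Ultrafilter.of_le l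
  have hU0 : (U : Filter (ℝ × ℝ)) ≤ 𝓝 0 := hUl.trans hl
  have ht0 : Tendsto (fun w : ℝ × ℝ => w.1) U (𝓝 0) := (continuous_fst.tendsto 0).mono_left hU0
  have hpos : ∀ᶠ w : ℝ × ℝ in U, 0 < w.1 := hUl (hcone.mono fun w h => h.1)
  obtain ⟨n, r', hr', rfl⟩ := exists_eq_X_pow_mul hr
  obtain ⟨LP, SP, hSP, hLP⟩ := (contDiff_evalEval P).contDiffAt.exists_lipschitzOnWith (x := 0)
  obtain ⟨LQ, SQ, hSQ, hLQ⟩ := (contDiff_evalEval Q).contDiffAt.exists_lipschitzOnWith (x := 0)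
  have hr'near : ∀ᶠ w : ℝ × ℝ in 𝓝 0, |r'.eval 0| / 2 < |r'.eval w.1| := by
    have : Tendsto (fun w : ℝ × ℝ => |r'.eval w.1|) (𝓝 0) (𝓝 |r'.eval 0|) :=
      ((r'.continuous.comp continuous_fst).abs.tendsto' _ _ rfl)
    exact this.eventually (lt_mem_nhds (half_lt_self (abs_pos.mpr hr')))
  set c := |r'.eval 0| / 2 with hc
  have hcpos : 0 < c := half_pos (abs_pos.mpr hr')
  set B := max K' 1 with hB
  have hBpos : 0 < B := lt_max_of_lt_right one_pos
  have hlower : ∀ᶠ w : ℝ × ℝ in 𝓝 0, 0 < w.1 → w.1 ^ n * (c / B) ≤ |Q.evalEval w.1 w.2| := by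
    filter_upwards [hrQ, hr'near] with w h1 h2 h3
    rw [eval_mul, eval_pow, eval_X, abs_mul, abs_pow, abs_of_pos h3] at h1
    rw [← mul_div_assoc, div_le_iff₀' hBpos]
    calc w.1 ^ n * c ≤ w.1 ^ n * |r'.eval w.1| := by gcongr
      _ ≤ K' * |Q.evalEval w.1 w.2| := h1
      _ ≤ B * |Q.evalEval w.1 w.2| := by gcongr; exact le_max_left _ _
  have hQne : ∀ᶠ w : ℝ × ℝ in 𝓝 0, 0 < w.1 → Q.evalEval w.1 w.2 ≠ 0 := by
    filter_upwards [hlower] with w h1 h2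
    exact abs_pos.mp (lt_of_lt_of_le (by positivity) (h1 h2))
  have hseg : ∀ᶠ w : ℝ × ℝ in U, ∀ y, |y| ≤ w.1 → Q.evalEval w.1 y ≠ 0 := by
    obtain ⟨ε, hε, hball⟩ := Metric.eventually_nhds_iff.mp hQne
    filter_upwards [hpos, ht0.eventually (gt_mem_nhds hε)] with w hw hwε y hy
    refine hball (y := (w.1, y)) ?_ hw
    rw [dist_zero_right, Prod.norm_def, max_lt_iff]
    exact ⟨by rwa [Real.norm_eq_abs, abs_of_pos hw], hy.trans_lt hwε⟩
  obtain ⟨F, hF0, hF⟩ := exists_root_abs_div_le (P - C (C d) * Q) Q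
  have hsub : ∀ u v : ℝ, Q.evalEval u v ≠ 0 →
      (P - C (C d) * Q).evalEval u v / Q.evalEval u v = P.evalEval u v / Q.evalEval u v - d := by
    intro u v h
    rw [evalEval_sub, evalEval_mul, evalEval_C, eval_C, sub_div, mul_div_cancel_right₀ _ h]
  have hex : ∀ᶠ w : ℝ × ℝ in U, ∃ y, |y| ≤ w.1 ∧ F.evalEval w.1 y = 0 ∧
      |P.evalEval w.1 y / Q.evalEval w.1 y - d| ≤
        |P.evalEval w.1 w.2 / Q.evalEval w.1 w.2 - d| := by
    filter_upwards [hUl hcone, hseg] with w hw hQw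
    obtain ⟨y, hy, hFy, hle⟩ := hF w.1 w.2 hw.1 hw.2 hQw
    rw [hsub _ _ (hQw y hy), hsub _ _ (hQw _ hw.2)] at hle
    exact ⟨y, hy, hFy, hle⟩
  obtain ⟨y, hy⟩ := hex.choice
  have hy0 : Tendsto y U (𝓝 0) :=
    squeeze_zero_norm' (hy.mono fun w h => h.1) ht0
  have hyd : Tendsto (fun w : ℝ × ℝ => P.evalEval w.1 (y w) / Q.evalEval w.1 (y w)) U (𝓝 d) := by
    have h1 := (tendsto_iff_norm_sub_tendsto_zero.mp (hd.mono_left hUl))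
    exact tendsto_iff_norm_sub_tendsto_zero.mpr
      (squeeze_zero' (Eventually.of_forall fun _ => norm_nonneg _) (hy.mono fun w h => h.2.2) h1)
  have hGne : F.comp (C X * X) ≠ 0 := by
    intro h
    refine hF0 (Polynomial.ext fun j => ?_)
    have h1 := congrArg (fun A => coeff A j) h
    rw [comp_C_mul_X_coeff, coeff_zero] at h1
    rw [coeff_zero]
    exact (mul_eq_zero.mp h1).resolve_right (pow_ne_zero _ X_ne_zero)
  -- The ratio `s = y / u` is a root of `F(u, u * s)` bounded by `1`. Order `n` for `s` is order `n
  -- + 1` for `y`, one more than the order `n` in the lower bound for `|Q|`.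
  obtain ⟨m, h, hm, happ⟩ := puiseuxApprox_of_root U hGne (t := fun w => w.1)
    (s := fun w => y w / w.1) (K := 1) n hpos ht0
    (by
      filter_upwards [hpos, hy] with w hw hyw
      rw [abs_div, abs_of_pos hw, div_le_one hw]
      exact hyw.1)
    (by
      filter_upwards [hpos, hy] with w hw hyw
      have h1 : (F.comp (C X * X)).evalEval w.1 (y w / w.1) = F.evalEval w.1 (y w) := by
        rw [evalEval, eval_comp, eval_eval_eq_evalEval]
        simp [div_mul_cancel₀ _ hw.ne']
      rw [h1, hyw.2.1])
  set g : ℝ × ℝ → ℝ := fun w => w.1 * h.eval (w.1 ^ ((m : ℝ)⁻¹)) with hg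
  have hg0 : Tendsto g U (𝓝 0) := by
    have h1 : Tendsto (fun w : ℝ × ℝ => w.1 ^ ((m : ℝ)⁻¹)) U (𝓝 (0 ^ ((m : ℝ)⁻¹))) :=
      ht0.rpow_const (Or.inr (by positivity))
    simpa using ht0.mul ((h.continuous.tendsto _).comp h1)
  obtain ⟨A, hApos, hA⟩ := happ.exists_pos
  have hdiff : ∀ᶠ w in U, |y w - g w| ≤ A * w.1 ^ n * w.1 := by
    filter_upwards [hpos, hA.bound] with w hw hAw
    rw [Real.norm_eq_abs, Real.norm_eq_abs, abs_of_pos (pow_pos hw n)] at hAw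
    have h1 : y w - g w = (y w / w.1 - h.eval (w.1 ^ ((m : ℝ)⁻¹))) * w.1 := by
      rw [hg, sub_mul, div_mul_cancel₀ _ hw.ne']
      ring
    rw [h1, abs_mul, abs_of_pos hw]
    gcongr
  have hpy : Tendsto (fun w : ℝ × ℝ => (w.1, y w)) U (𝓝 0) := ht0.prodMk_nhds hy0
  have hpg : Tendsto (fun w : ℝ × ℝ => (w.1, g w)) U (𝓝 0) := ht0.prodMk_nhds hg0
  have hlim : Tendsto (fun w : ℝ × ℝ => P.evalEval w.1 (g w) / Q.evalEval w.1 (g w)) U (𝓝 d) := by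
    have hzero : Tendsto (fun w : ℝ × ℝ =>
        P.evalEval w.1 (y w) / Q.evalEval w.1 (y w) -
          P.evalEval w.1 (g w) / Q.evalEval w.1 (g w)) U (𝓝 0) := by
      have hub : Tendsto (fun w : ℝ × ℝ => (K + 1) * ((LP + LQ) * A) / (c / B) * w.1) U (𝓝 0) := by
        simpa using ht0.const_mul ((K + 1) * ((LP + LQ) * A) / (c / B))
      refine squeeze_zero_norm' ?_ hub
      filter_upwards [hpos, hdiff, hpy.eventually hQne, hpg.eventually hQne, hpg.eventually hlower,
        hpy.eventually hPQ, hpy hSP, hpy hSQ, hpg hSP, hpg hSQ] with w hw hdw hq₁ hq₂ hlo hK h1 h2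
        h3 h4
      have hdist : dist (w.1, y w) (w.1, g w) = |y w - g w| := by
        simp [Prod.dist_eq, Real.dist_eq]
      have hp' := hLP.dist_le_mul _ h1 _ h3
      have hq' := hLQ.dist_le_mul _ h2 _ h4
      rw [hdist, Real.dist_eq] at hp' hq'
      have hp'' : |P.evalEval w.1 (y w) - P.evalEval w.1 (g w)| ≤
          (LP + LQ) * (A * w.1 ^ n * w.1) := by
        refine hp'.trans ?_
        gcongr
        exact le_add_of_nonneg_right LQ.2
      have hq'' : |Q.evalEval w.1 (y w) - Q.evalEval w.1 (g w)| ≤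
          (LP + LQ) * (A * w.1 ^ n * w.1) := by
        refine hq'.trans ?_
        gcongr
        exact le_add_of_nonneg_left LP.2
      have hK0 : 0 ≤ K := nonneg_of_mul_nonneg_left ((abs_nonneg _).trans hK)
        (abs_pos.mpr (hq₁ hw))
      calc _ ≤ (K + 1) * ((LP + LQ) * (A * w.1 ^ n * w.1)) / |Q.evalEval w.1 (g w)| :=
            abs_div_sub_div_le (hq₁ hw) (hq₂ hw) hK hp'' hq''
        _ ≤ (K + 1) * ((LP + LQ) * (A * w.1 ^ n * w.1)) / (w.1 ^ n * (c / B)) := by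
            gcongr
            exact hlo hw
        _ = _ := by
            have := pow_pos hw n
            field_simp
    simpa using hyd.sub hzero
  -- The curve `g` depends on `w.1` only, so the limit passes to the image filter on the `u`-axis.
  refine ⟨m, h, map Prod.fst (U : Filter (ℝ × ℝ)), hm, inferInstance, ?_, tendsto_map'_iff.mpr hlim⟩
  exact tendsto_nhdsWithin_iff.mpr ⟨ht0, hpos⟩

/-! ### Characters given by limits along curves -/

lemma quot_eq_div {f : Rat2} {a b : Poly2} {w : ℝ × ℝ}
    (hf : f = algebraMap Poly2 Rat2 a / algebraMap Poly2 Rat2 b) (hb : pval b w ≠ 0)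
    (hd : pval (den f) w ≠ 0) : quot f w = pval a w / pval b w := by
  have inj := IsFractionRing.injective Poly2 Rat2
  have hb0 : b ≠ 0 := by
    rintro rfl
    exact hb (by simp [pval])
  have hcross : num f * b = a * den f := by
    apply inj
    have h := (num_div_den f).trans hf
    rw [div_eq_div_iff ((map_ne_zero_iff _ inj).mpr (den_ne_zero f))
      ((map_ne_zero_iff _ inj).mpr hb0)] at h
    simpa [map_mul] using h
  rw [quot, div_eq_div_iff hd hb]
  simpa [pval] using congrArg (fun p => pval p w) hcross

lemma quot_mul {f g : Rat2} {w : ℝ × ℝ} (hf : pval (den f) w ≠ 0) (hg : pval (den g) w ≠ 0)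
    (hfg : pval (den (f * g)) w ≠ 0) : quot (f * g) w = quot f w * quot g w := by
  rw [quot_eq_div (a := num f * num g) (b := den f * den g) _ _ hfg]
  · simp [pval, quot, mul_div_mul_comm]
  · rw [map_mul, map_mul, mul_div_mul_comm, num_div_den, num_div_den]
  · simpa [pval] using ⟨hf, hg⟩

lemma quot_add {f g : Rat2} {w : ℝ × ℝ} (hf : pval (den f) w ≠ 0) (hg : pval (den g) w ≠ 0)
    (hfg : pval (den (f + g)) w ≠ 0) : quot (f + g) w = quot f w + quot g w := by
  have inj := IsFractionRing.injective Poly2 Rat2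
  rw [quot_eq_div (a := num f * den g + den f * num g) (b := den f * den g) _ _ hfg]
  · rw [quot, quot, div_add_div _ _ hf hg]
    simp [pval]
  · rw [map_mul, map_add, map_mul, map_mul, ← div_add_div _ _
        ((map_ne_zero_iff _ inj).mpr (den_ne_zero f))
        ((map_ne_zero_iff _ inj).mpr (den_ne_zero g)), num_div_den, num_div_den]
  · simpa [pval] using ⟨hf, hg⟩

lemma quot_algebraMap {c : ℝ} {w : ℝ × ℝ} (h : pval (den (algebraMap ℝ Rat2 c)) w ≠ 0) :
    quot (algebraMap ℝ Rat2 c) w = c := by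
  rw [quot_eq_div (a := MvPolynomial.C c) (b := 1) _ _ h]
  · simp [pval]
  · rw [map_one, div_one]
    exact IsScalarTower.algebraMap_apply ℝ Poly2 Rat2 c
  · simp [pval]

/-- If all locally bounded rational functions have limits along a family of points, these limits form a
character. -/
lemma exists_character {ι : Type} {l : Filter ι} [l.NeBot] {z : ℝ × ℝ} {γ : ι → ℝ × ℝ}
    (hγ : Tendsto γ l (𝓝[≠] z))
    (hlim : ∀ g : Rat2, BoundedNear g z → ∃ L, Tendsto (fun i => quot g (γ i)) l (𝓝 L)) :
    ∃ χ : Character z, DeterminedAlong χ l γ ∧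
      ∀ g : boundedRat z, Tendsto (fun i => quot (g : Rat2) (γ i)) l (𝓝 (χ g)) := by
  choose! L hL using hlim
  have hL' : ∀ g : boundedRat z, Tendsto (fun i => quot (g : Rat2) (γ i)) l (𝓝 (L g)) :=
    fun g => hL g g.2
  have hden : ∀ g : boundedRat z, ∀ᶠ i in l, pval (den (g : Rat2)) (γ i) ≠ 0 := fun g =>
    hγ.eventually (BoundedNear.eventually_den_ne_zero g.2)
  have hconst : ∀ c : ℝ, L (algebraMap ℝ (boundedRat z) c : boundedRat z) = c := by
    intro c
    refine tendsto_nhds_unique (hL' (algebraMap ℝ (boundedRat z) c)) ?_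
    refine tendsto_const_nhds.congr' ?_
    filter_upwards [hden (algebraMap ℝ (boundedRat z) c)] with i hi
    exact (quot_algebraMap hi).symm
  let χ : Character z :=
    { toFun := fun g => L g
      map_one' := by simpa using hconst 1
      map_zero' := by simpa using hconst 0
      map_mul' := fun f g => by
        refine tendsto_nhds_unique (hL' (f * g)) (((hL' f).mul (hL' g)).congr' ?_)
        filter_upwards [hden f, hden g, hden (f * g)] with i h1 h2 h3
        exact (quot_mul h1 h2 h3).symm
      map_add' := fun f g => by
        refine tendsto_nhds_unique (hL' (f + g)) (((hL' f).add (hL' g)).congr' ?_)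
        filter_upwards [hden f, hden g, hden (f + g)] with i h1 h2 h3
        exact (quot_add h1 h2 h3).symm
      commutes' := hconst }
  refine ⟨χ, ⟨hγ.mono_right nhdsWithin_le_nhds, fun g => (hL' g).congr' ?_⟩, hL'⟩
  filter_upwards [hγ.eventually (BoundedNear.eventually_value_eq g.2)] with i hi
  exact hi.symm

lemma DeterminedAlong.comp {ι κ : Type} {z : ℝ × ℝ} {χ : Character z} {l : Filter ι}
    {γ : ι → ℝ × ℝ} (h : DeterminedAlong χ l γ) {l' : Filter κ} {σ : κ → ι}
    (hσ : Tendsto σ l' l) : DeterminedAlong χ l' (γ ∘ σ) :=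
  ⟨h.1.comp hσ, fun g => (h.2 g).comp hσ⟩

lemma tendsto_rpow_inv_nhdsGT {m : ℕ} (hm : m ≠ 0) :
    Tendsto (fun u : ℝ => u ^ ((m : ℝ)⁻¹)) (𝓝[>] 0) (𝓝[>] 0) := by
  refine tendsto_nhdsWithin_iff.mpr ⟨?_, ?_⟩
  · have h := (tendsto_id (α := ℝ) (x := 𝓝 0)).rpow_const (p := (m : ℝ)⁻¹)
      (Or.inr (by positivity))
    rw [Real.zero_rpow (by positivity)] at h
    exact h.mono_left nhdsWithin_le_nhds
  · filter_upwards [self_mem_nhdsWithin] with u hu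
    exact Real.rpow_pos_of_pos hu _

/-- Locally bounded rational functions have limits along the curves `v = u * h(u ^ (1 / m))`, in any
polynomial coordinates. -/
lemma BoundedNear.exists_tendsto_branch {g : Rat2} {a b : ℝ[X][X]}
    (hg : BoundedNear g (a.evalEval 0 0, b.evalEval 0 0)) {m : ℕ} (hm : m ≠ 0) (h : ℝ[X]) :
    ∃ L, Tendsto (fun u => quot g (a.evalEval u (u * h.eval (u ^ ((m : ℝ)⁻¹))),
      b.evalEval u (u * h.eval (u ^ ((m : ℝ)⁻¹))))) (𝓝[>] 0) (𝓝 L) := by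
  -- The substitution `u = τ ^ m` turns the branch into a polynomial curve.
  have hcurve : ∀ A : ℝ[X][X], ∃ A' : ℝ[X], ∀ τ : ℝ,
      A'.eval τ = A.evalEval (τ ^ m) (τ ^ m * h.eval τ) := by
    intro A
    refine ⟨aevalAeval (X ^ m) (X ^ m * h) A, fun τ => ?_⟩
    have h1 : (Polynomial.aeval τ).comp (aevalAeval (R := ℝ) (X ^ m) (X ^ m * h)) =
        aevalAeval (R := ℝ) (τ ^ m) (τ ^ m * h.eval τ) := by
      ext <;> simp [coe_aeval_eq_eval]
    have h2 := AlgHom.congr_fun h1 A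
    rwa [AlgHom.comp_apply, coe_aevalAeval_eq_evalEval, coe_aeval_eq_eval] at h2
  obtain ⟨a', ha'⟩ := hcurve a
  obtain ⟨b', hb'⟩ := hcurve b
  obtain ⟨L, hL⟩ := BoundedNear.exists_tendsto_polynomial_curve (f := g) a' b'
    (by simpa [ha', hb', zero_pow hm] using hg) (nhdsGT_le_nhdsNE (0 : ℝ))
  refine ⟨L, (hL.comp (tendsto_rpow_inv_nhdsGT hm)).congr' ?_⟩
  filter_upwards [self_mem_nhdsWithin] with u hu
  rw [Function.comp_apply, ha', hb', Real.rpow_inv_natCast_pow (le_of_lt hu) hm]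

/-- A limiting value in the cone `|v| ≤ u` of some polynomial coordinates is the limit along a curve
`v = u * h(u ^ (1 / m))`. -/
lemma BoundedNear.exists_branch {f : Rat2} {a b : ℝ[X][X]}
    (hf : BoundedNear f (a.evalEval 0 0, b.evalEval 0 0)) {r : ℝ[X]} {K : ℝ} (hr : r ≠ 0)
    (hrf : ∀ᶠ w : ℝ × ℝ in 𝓝 0,
      |r.eval w.1| ≤ K * |pval (den f) (a.evalEval w.1 w.2, b.evalEval w.1 w.2)|)
    {l : Filter (ℝ × ℝ)} [l.NeBot] (hl : l ≤ 𝓝 0) (hcone : ∀ᶠ w in l, 0 < w.1 ∧ |w.2| ≤ w.1)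
    {d : ℝ} (hd : Tendsto (fun w => quot f (a.evalEval w.1 w.2, b.evalEval w.1 w.2)) l (𝓝 d)) :
    ∃ (m : ℕ) (h : ℝ[X]), m ≠ 0 ∧
      Tendsto (fun u => quot f (a.evalEval u (u * h.eval (u ^ ((m : ℝ)⁻¹))),
        b.evalEval u (u * h.eval (u ^ ((m : ℝ)⁻¹))))) (𝓝[>] 0) (𝓝 d) := by
  obtain ⟨K₁, -, hK₁⟩ := hf.abs_num_le
  have ht : Tendsto (fun w : ℝ × ℝ => (a.evalEval w.1 w.2, b.evalEval w.1 w.2)) (𝓝 0)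
      (𝓝 (a.evalEval 0 0, b.evalEval 0 0)) :=
    ((continuous_evalEval a).prodMk (continuous_evalEval b)).tendsto 0
  obtain ⟨m, h, l', hm, hne, hl', hlim⟩ := exists_curve_of_tendsto_in_cone
    (P := MvPolynomial.aeval ![a, b] (num f)) (Q := MvPolynomial.aeval ![a, b] (den f)) hr
    (by simpa only [evalEval_aeval_eq_pval] using ht.eventually hK₁)
    (by simpa only [evalEval_aeval_eq_pval] using hrf) hl hcone
    (by simpa only [evalEval_aeval_eq_pval, quot] using hd)
  simp only [evalEval_aeval_eq_pval] at hlim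
  obtain ⟨L, hL⟩ := hf.exists_tendsto_branch hm h
  -- The limit exists along the whole branch, so its value along the finer filter `l'` determines
  -- it.
  have : L = d := tendsto_nhds_unique (hL.mono_left hl') hlim
  exact ⟨m, h, hm, this ▸ hL⟩

/-- The exponents are `1 + i / m` for `i` in the support of `h`; the factor `|t|` is what makes them
at least `1`. -/
lemma exists_puiseuxSum {m : ℕ} (hm : m ≠ 0) (h : ℝ[X]) :
    ∃ Φ ∈ puiseuxSums, ∀ t, Φ t = |t| * h.eval (|t| ^ ((m : ℝ)⁻¹)) := by
  let e := h.support.orderEmbOfFin rfl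
  have hmq : (0 : ℚ) < m := by exact_mod_cast Nat.pos_of_ne_zero hm
  refine ⟨_, ⟨h.support.card, fun k => h.coeff (e k), fun k => 1 + (e k : ℚ) / m, ?_, ?_, ?_, rfl⟩,
    fun t => ?_⟩
  · exact fun k => mem_support_iff.mp (h.support.orderEmbOfFin_mem rfl k)
  · exact fun k => le_add_of_nonneg_right (by positivity)
  · intro i j hij
    have : ((e i : ℕ) : ℚ) < (e j : ℕ) := by exact_mod_cast e.strictMono hij
    simp only
    gcongr
  · have hsum : ∑ i ∈ h.support, h.coeff i * |t| ^ (((1 + (i : ℚ) / m : ℚ)) : ℝ) =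
        ∑ k, h.coeff (e k) * |t| ^ (((1 + (e k : ℚ) / m : ℚ)) : ℝ) := by
      conv_lhs => rw [← Finset.map_orderEmbOfFin_univ h.support rfl, Finset.sum_map]
      rfl
    rw [← hsum, eval_eq_sum, Polynomial.sum_def, Finset.mul_sum]
    refine Finset.sum_congr rfl fun i _ => ?_
    have h1 : |t| ^ (((1 + (i : ℚ) / m : ℚ)) : ℝ) = |t| * (|t| ^ ((m : ℝ)⁻¹)) ^ i := by
      push_cast
      rw [Real.rpow_add_of_nonneg (abs_nonneg t) zero_le_one (by positivity), Real.rpow_one,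
        ← Real.rpow_natCast, ← Real.rpow_mul (abs_nonneg t)]
      congr 2
      field_simp
    rw [h1]
    ring

/-- The points lie on the curve, so the difference is exactly zero, and the slope tends to `σ *
h(0)`. Evenness of `Φ` lets one sum serve both signs `σ`. -/
lemma flatToPuiseuxSum_of_eq {m : ℕ} (hm : m ≠ 0) {h : ℝ[X]} {Φ : ℝ → ℝ} (hΦ : Φ ∈ puiseuxSums)
    (hΦh : ∀ t, Φ t = |t| * h.eval (|t| ^ ((m : ℝ)⁻¹))) {σ : ℝ} (hσ : σ = 1 ∨ σ = -1)
    {ι : Type} {l : Filter ι} {u : ι → ℝ} (hu : ∀ i, 0 < u i) (hu0 : Tendsto u l (𝓝 0)) :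
    FlatToPuiseuxSum l (fun i => σ * u i) (fun i => Φ (u i)) := by
  have heven : ∀ i, Φ (σ * u i) = Φ (u i) := by
    intro i
    have : |σ| = 1 := by rcases hσ with rfl | rfl <;> simp
    rw [hΦh, hΦh, abs_mul, this, one_mul]
  refine ⟨?_, ⟨σ * h.eval 0, ?_⟩, Φ, hΦ, fun e => ?_⟩
  · rcases hσ with rfl | rfl
    · exact Or.inl fun i => by simpa using hu i
    · exact Or.inr fun i => by simpa using hu i
  · have h1 := hu0.rpow_const (p := (m : ℝ)⁻¹) (Or.inr (by positivity))
    rw [Real.zero_rpow (by positivity)] at h1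
    refine (((h.continuous.tendsto 0).comp h1).const_mul σ).congr fun i => ?_
    have h2 := (hu i).ne'
    simp only [hΦh, abs_of_pos (hu i), Function.comp_apply]
    rcases hσ with rfl | rfl <;> field_simp
  · simp only [heven, sub_self, zero_div]
    exact tendsto_const_nhds

/-- A limiting value in the cone `|v| ≤ u` of some polynomial coordinates is attained by a character that
is determined by the graph of a sum of rational powers in these coordinates. -/
lemma BoundedNear.exists_character_of_cone {f : Rat2} {z : ℝ × ℝ} (hf : BoundedNear f z)
    {a b : ℝ[X][X]} (hz : (a.evalEval 0 0, b.evalEval 0 0) = z)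
    (hinj : ∀ u v, 0 < u → (a.evalEval u v, b.evalEval u v) ≠ z)
    {r : ℝ[X]} {K : ℝ} (hr : r ≠ 0)
    (hrf : ∀ᶠ w : ℝ × ℝ in 𝓝 0,
      |r.eval w.1| ≤ K * |pval (den f) (a.evalEval w.1 w.2, b.evalEval w.1 w.2)|)
    {l : Filter (ℝ × ℝ)} [l.NeBot] (hl : l ≤ 𝓝 0) (hcone : ∀ᶠ w in l, 0 < w.1 ∧ |w.2| ≤ w.1)
    {d : ℝ} (hd : Tendsto (fun w => quot f (a.evalEval w.1 w.2, b.evalEval w.1 w.2)) l (𝓝 d)) :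
    ∃ χ : Character z, χ ⟨f, hf⟩ = d ∧ ∃ Φ ∈ puiseuxSums, (∀ t, Φ (-t) = Φ t) ∧
      (∀ σ : ℝ, (σ = 1 ∨ σ = -1) →
        FlatToPuiseuxSum atTop (fun n : ℕ => σ * (1 / ((n : ℝ) + 1)))
          (fun n : ℕ => Φ (1 / ((n : ℝ) + 1)))) ∧
      DeterminedAlong χ (𝓝[>] 0) (fun u => (a.evalEval u (Φ u), b.evalEval u (Φ u))) := by
  subst hz
  obtain ⟨m, h, hm, hlim⟩ := hf.exists_branch hr hrf hl hcone hd
  obtain ⟨Φ, hΦ, hΦh⟩ := exists_puiseuxSum hm h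
  have hpos : ∀ u : ℝ, 0 < u → u * h.eval (u ^ ((m : ℝ)⁻¹)) = Φ u := fun u hu => by
    rw [hΦh, abs_of_pos hu]
  have hcongr : ∀ {g : Rat2} {L : ℝ},
      Tendsto (fun u => quot g (a.evalEval u (u * h.eval (u ^ ((m : ℝ)⁻¹))),
        b.evalEval u (u * h.eval (u ^ ((m : ℝ)⁻¹))))) (𝓝[>] 0) (𝓝 L) →
      Tendsto (fun u => quot g (a.evalEval u (Φ u), b.evalEval u (Φ u))) (𝓝[>] 0) (𝓝 L) := by
    intro g L hg
    refine hg.congr' ?_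
    filter_upwards [self_mem_nhdsWithin] with u hu
    rw [hpos u hu]
  have hΦ0 : Tendsto Φ (𝓝[>] 0) (𝓝 0) := by
    have h1 := ((h.continuous.tendsto 0).comp
      ((tendsto_rpow_inv_nhdsGT hm).mono_right nhdsWithin_le_nhds))
    have h2 := ((tendsto_id (α := ℝ) (x := 𝓝 0)).mono_left (nhdsWithin_le_nhds (s := Set.Ioi 0))).mul h1
    rw [zero_mul] at h2
    refine h2.congr' ?_
    filter_upwards [self_mem_nhdsWithin] with u hu
    exact hpos u hu
  have hid : Tendsto (fun u : ℝ => u) (𝓝[>] 0) (𝓝 0) := nhdsWithin_le_nhds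
  have hγ : Tendsto (fun u => (a.evalEval u (Φ u), b.evalEval u (Φ u))) (𝓝[>] 0)
      (𝓝[≠] (a.evalEval 0 0, b.evalEval 0 0)) := by
    refine tendsto_nhdsWithin_iff.mpr
      ⟨(tendsto_evalEval a hid hΦ0).prodMk_nhds (tendsto_evalEval b hid hΦ0), ?_⟩
    filter_upwards [self_mem_nhdsWithin] with u hu
    exact hinj u _ hu
  obtain ⟨χ, hχ, hχ'⟩ := exists_character hγ fun g hg => by
    obtain ⟨L, hL⟩ := hg.exists_tendsto_branch hm h
    exact ⟨L, hcongr hL⟩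
  refine ⟨χ, tendsto_nhds_unique (hχ' ⟨f, hf⟩) (hcongr hlim), Φ, hΦ, fun t => ?_, fun σ hσ => ?_, hχ⟩
  · rw [hΦh, hΦh, abs_neg]
  · exact flatToPuiseuxSum_of_eq hm hΦ hΦh hσ (fun n => by positivity)
      tendsto_one_div_add_atTop_nhds_zero_nat

/-! ### The four cones at the point -/

lemma tendsto_one_div_nhdsGT : Tendsto (fun n : ℕ => 1 / ((n : ℝ) + 1)) atTop (𝓝[>] 0) :=
  tendsto_nhdsWithin_iff.mpr ⟨tendsto_one_div_add_atTop_nhds_zero_nat,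
    Eventually.of_forall fun n => by simp only [Set.mem_Ioi]; positivity⟩

lemma tendsto_sub_nhdsGT (x : ℝ) : Tendsto (fun t => t - x) (𝓝[>] x) (𝓝[>] 0) := by
  refine tendsto_nhdsWithin_iff.mpr ⟨?_, ?_⟩
  · exact ((continuous_id.sub continuous_const).tendsto' _ _ (sub_self x)).mono_left
      nhdsWithin_le_nhds
  · filter_upwards [self_mem_nhdsWithin] with t ht
    exact Set.mem_Ioi.mpr (sub_pos.mpr (Set.mem_Ioi.mp ht))

lemma tendsto_sub_nhdsLT (x : ℝ) : Tendsto (fun t => x - t) (𝓝[<] x) (𝓝[>] 0) := by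
  refine tendsto_nhdsWithin_iff.mpr ⟨?_, ?_⟩
  · exact ((continuous_const.sub continuous_id).tendsto' _ _ (sub_self x)).mono_left
      nhdsWithin_le_nhds
  · filter_upwards [self_mem_nhdsWithin] with t ht
    exact Set.mem_Ioi.mpr (sub_pos.mpr (Set.mem_Iio.mp ht))

lemma comp_affine_ne_zero {r : ℝ[X]} (hr : r ≠ 0) (c : ℝ) {σ : ℝ} (hσ : σ ≠ 0) :
    r.comp (C c + C σ * X) ≠ 0 := by
  intro h
  rw [comp_eq_zero_iff] at h
  rcases h with h | ⟨-, h⟩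
  · exact hr h
  · have := congrArg (fun p => coeff p 1) h
    simp at this
    exact hσ this

/-- Limiting values reached in one of the two horizontal cones at `(x₀, y₀)`. -/
lemma BoundedNear.exists_character_graphX {f : Rat2} {x₀ y₀ : ℝ} (hf : BoundedNear f (x₀, y₀))
    {σ : ℝ} (hσ : σ = 1 ∨ σ = -1) {l : Filter (ℝ × ℝ)} [l.NeBot] (hl : l ≤ 𝓝 (x₀, y₀))
    (hcone : ∀ᶠ w in l, 0 < σ * (w.1 - x₀) ∧ |w.2 - y₀| ≤ σ * (w.1 - x₀)) {d : ℝ}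
    (hd : Tendsto (quot f) l (𝓝 d)) :
    ∃ χ ∈ X1 x₀ y₀, χ ⟨f, hf⟩ = d ∧ ∃ Φ ∈ puiseuxSums, DeterminedByGraphX χ Φ := by
  have hσσ : σ * σ = 1 := by rcases hσ with rfl | rfl <;> norm_num
  have hσ0 : σ ≠ 0 := by rintro rfl; simp at hσσ
  -- The coordinates `u = σ * (x - x₀)`, `v = y - y₀` carry the cone to `|v| ≤ u`.
  set a : ℝ[X][X] := C (C x₀ + C σ * X) with ha
  set b : ℝ[X][X] := C (C y₀) + X with hb
  have hae : ∀ u v : ℝ, a.evalEval u v = x₀ + σ * u := fun u v => by simp [ha, evalEval]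
  have hbe : ∀ u v : ℝ, b.evalEval u v = y₀ + v := fun u v => by simp [hb, evalEval]
  obtain ⟨r, K, hr, hrK⟩ := hf.exists_le_den_fst
  have hTS : ∀ w : ℝ × ℝ, (x₀ + σ * (σ * (w.1 - x₀)), y₀ + (w.2 - y₀)) = w := fun w => by
    rw [← mul_assoc, hσσ]
    ext <;> simp
  have hT : Tendsto (fun w : ℝ × ℝ => (x₀ + σ * w.1, y₀ + w.2)) (𝓝 0) (𝓝 (x₀, y₀)) :=
    Continuous.tendsto' (by fun_prop) _ _ (by simp)
  have hS : Tendsto (fun w : ℝ × ℝ => (σ * (w.1 - x₀), w.2 - y₀)) (𝓝 (x₀, y₀)) (𝓝 0) :=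
    Continuous.tendsto' (by fun_prop) _ _ (by simp)
  obtain ⟨χ, hχf, Φ, hΦ, heven, hflat, hχ⟩ := hf.exists_character_of_cone (a := a) (b := b)
    (by simp [hae, hbe])
    (fun u v hu h => by
      simp only [hae, hbe, Prod.mk.injEq, add_eq_left, mul_eq_zero] at h
      exact h.1.elim hσ0 hu.ne')
    (comp_affine_ne_zero hr x₀ hσ0) (K := K)
    (by simpa [hae, hbe] using hT.eventually hrK)
    (l := map (fun w : ℝ × ℝ => (σ * (w.1 - x₀), w.2 - y₀)) l) (hS.mono_left hl)
    (eventually_map.mpr hcone)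
    (by
      rw [tendsto_map'_iff]
      simpa only [Function.comp_def, hae, hbe, hTS] using hd)
  simp only [hae, hbe] at hχ
  -- Sampling the branch at `u = 1 / (n + 1)` supplies the net required by `X1`.
  refine ⟨χ, ⟨ℕ, inferInstance, inferInstance, inferInstance, _, hχ.comp tendsto_one_div_nhdsGT,
    Or.inl ?_⟩, hχf, Φ, hΦ, ?_⟩
  · simpa using hflat σ hσ
  · rcases hσ with rfl | rfl
    · left
      simpa [Function.comp_def] using hχ.comp (tendsto_sub_nhdsGT x₀)
    · right
      have h1 := hχ.comp (tendsto_sub_nhdsLT x₀)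
      have h2 : ∀ x, Φ (x₀ - x) = Φ (x - x₀) := fun x => by rw [← heven, neg_sub]
      simpa [Function.comp_def, h2] using h1

/-- Limiting values reached in one of the two vertical cones at `(x₀, y₀)`. -/
lemma BoundedNear.exists_character_graphY {f : Rat2} {x₀ y₀ : ℝ} (hf : BoundedNear f (x₀, y₀))
    {σ : ℝ} (hσ : σ = 1 ∨ σ = -1) {l : Filter (ℝ × ℝ)} [l.NeBot] (hl : l ≤ 𝓝 (x₀, y₀))
    (hcone : ∀ᶠ w in l, 0 < σ * (w.2 - y₀) ∧ |w.1 - x₀| ≤ σ * (w.2 - y₀)) {d : ℝ}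
    (hd : Tendsto (quot f) l (𝓝 d)) :
    ∃ χ ∈ X1 x₀ y₀, χ ⟨f, hf⟩ = d ∧ ∃ Φ ∈ puiseuxSums, DeterminedByGraphY χ Φ := by
  have hσσ : σ * σ = 1 := by rcases hσ with rfl | rfl <;> norm_num
  have hσ0 : σ ≠ 0 := by rintro rfl; simp at hσσ
  -- Here `u = σ * (y - y₀)` and `v = x - x₀`, so the lower bound on the denominator must come from
  -- `exists_le_den_snd`.
  set a : ℝ[X][X] := C (C x₀) + X with ha
  set b : ℝ[X][X] := C (C y₀ + C σ * X) with hb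
  have hae : ∀ u v : ℝ, a.evalEval u v = x₀ + v := fun u v => by simp [ha, evalEval]
  have hbe : ∀ u v : ℝ, b.evalEval u v = y₀ + σ * u := fun u v => by simp [hb, evalEval]
  obtain ⟨r, K, hr, hrK⟩ := hf.exists_le_den_snd
  have hTS : ∀ w : ℝ × ℝ, (x₀ + (w.1 - x₀), y₀ + σ * (σ * (w.2 - y₀))) = w := fun w => by
    rw [← mul_assoc, hσσ]
    ext <;> simp
  have hT : Tendsto (fun w : ℝ × ℝ => (x₀ + w.2, y₀ + σ * w.1)) (𝓝 0) (𝓝 (x₀, y₀)) :=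
    Continuous.tendsto' (by fun_prop) _ _ (by simp)
  have hS : Tendsto (fun w : ℝ × ℝ => (σ * (w.2 - y₀), w.1 - x₀)) (𝓝 (x₀, y₀)) (𝓝 0) :=
    Continuous.tendsto' (by fun_prop) _ _ (by simp)
  obtain ⟨χ, hχf, Φ, hΦ, heven, hflat, hχ⟩ := hf.exists_character_of_cone (a := a) (b := b)
    (by simp [hae, hbe])
    (fun u v hu h => by
      simp only [hae, hbe, Prod.mk.injEq, add_eq_left, mul_eq_zero] at h
      exact h.2.elim hσ0 hu.ne')
    (comp_affine_ne_zero hr y₀ hσ0) (K := K)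
    (by simpa [hae, hbe] using hT.eventually hrK)
    (l := map (fun w : ℝ × ℝ => (σ * (w.2 - y₀), w.1 - x₀)) l) (hS.mono_left hl)
    (eventually_map.mpr hcone)
    (by
      rw [tendsto_map'_iff]
      simpa only [Function.comp_def, hae, hbe, hTS] using hd)
  simp only [hae, hbe] at hχ
  refine ⟨χ, ⟨ℕ, inferInstance, inferInstance, inferInstance, _, hχ.comp tendsto_one_div_nhdsGT,
    Or.inr ?_⟩, hχf, Φ, hΦ, ?_⟩
  · simpa using hflat σ hσ
  · rcases hσ with rfl | rfl
    · left
      simpa [Function.comp_def] using hχ.comp (tendsto_sub_nhdsGT y₀)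
    · right
      have h1 := hχ.comp (tendsto_sub_nhdsLT y₀)
      have h2 : ∀ y, Φ (y₀ - y) = Φ (y - y₀) := fun y => by rw [← heven, neg_sub]
      simpa [Function.comp_def, h2] using h1

end RatLim

end

theorem theorem4 (x₀ y₀ : ℝ) (f : RatLim.Rat2) (hf : f ∈ RatLim.boundedRat (x₀, y₀))
    (d : ℝ) (hd : d ∈ RatLim.limitingValues f (x₀, y₀)) :
    ∃ χ ∈ RatLim.X1 x₀ y₀, χ ⟨f, hf⟩ = d ∧
      ∃ Φ ∈ RatLim.puiseuxSums,
        RatLim.DeterminedByGraphX χ Φ ∨ RatLim.DeterminedByGraphY χ Φ := by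
  have hb : RatLim.BoundedNear f (x₀, y₀) := hf
  obtain ⟨U, hU, hUd⟩ := mapClusterPt_iff_ultrafilter.mp (hb.mapClusterPt_of_mem_limitingValues hd)
  have hU0 : (U : Filter (ℝ × ℝ)) ≤ 𝓝 (x₀, y₀) := hU.trans nhdsWithin_le_nhds
  -- The four closed cones around the half-axes cover the punctured plane, so the ultrafilter
  -- contains one of them.
  have hcover : ∀ᶠ w : ℝ × ℝ in U, ∃ σ : ℝ, (σ = 1 ∨ σ = -1) ∧
      ((0 < σ * (w.1 - x₀) ∧ |w.2 - y₀| ≤ σ * (w.1 - x₀)) ∨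
        (0 < σ * (w.2 - y₀) ∧ |w.1 - x₀| ≤ σ * (w.2 - y₀))) := by
    filter_upwards [hU self_mem_nhdsWithin] with w hw
    have hsign : ∀ s : ℝ, ∃ σ : ℝ, (σ = 1 ∨ σ = -1) ∧ σ * s = |s| := fun s =>
      (abs_choice s).elim (fun h => ⟨1, Or.inl rfl, by rw [h, one_mul]⟩)
        fun h => ⟨-1, Or.inr rfl, by rw [h, neg_one_mul]⟩
    rcases le_total |w.2 - y₀| |w.1 - x₀| with hle | hle
    · obtain ⟨σ, hσ, hs⟩ := hsign (w.1 - x₀)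
      refine ⟨σ, hσ, Or.inl ⟨?_, hs ▸ hle⟩⟩
      rw [hs, abs_pos]
      intro h0
      rw [h0, abs_zero, abs_nonpos_iff] at hle
      exact hw (Prod.ext (sub_eq_zero.mp h0) (sub_eq_zero.mp hle))
    · obtain ⟨σ, hσ, hs⟩ := hsign (w.2 - y₀)
      refine ⟨σ, hσ, Or.inr ⟨?_, hs ▸ hle⟩⟩
      rw [hs, abs_pos]
      intro h0
      rw [h0, abs_zero, abs_nonpos_iff] at hle
      exact hw (Prod.ext (sub_eq_zero.mp hle) (sub_eq_zero.mp h0))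
  have hcase : ∃ σ : ℝ, (σ = 1 ∨ σ = -1) ∧
      ((∀ᶠ w : ℝ × ℝ in U, 0 < σ * (w.1 - x₀) ∧ |w.2 - y₀| ≤ σ * (w.1 - x₀)) ∨
        ∀ᶠ w : ℝ × ℝ in U, 0 < σ * (w.2 - y₀) ∧ |w.1 - x₀| ≤ σ * (w.2 - y₀)) := by
    have h1 := hcover.mono fun w h => show _ ∨ _ by
      obtain ⟨σ, rfl | rfl, h⟩ := h
      · exact Or.inl h
      · exact Or.inr h
    rw [Ultrafilter.eventually_or, Ultrafilter.eventually_or, Ultrafilter.eventually_or] at h1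
    exact h1.elim (fun h => ⟨1, Or.inl rfl, h⟩) fun h => ⟨-1, Or.inr rfl, h⟩
  obtain ⟨σ, hσ, hX | hY⟩ := hcase
  · obtain ⟨χ, hχ, hχf, Φ, hΦ, hdet⟩ := hb.exists_character_graphX hσ hU0 hX hUd
    exact ⟨χ, hχ, hχf, Φ, hΦ, Or.inl hdet⟩
  · obtain ⟨χ, hχ, hχf, Φ, hΦ, hdet⟩ := hb.exists_character_graphY hσ hU0 hY hUd
    exact ⟨χ, hχ, hχf, Φ, hΦ, Or.inr hdet⟩
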